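/- Let $\mathbf k$ be a field. For $n\ge 0$ let $\mathcal T(n)$ be the set of rooted (non-planar) trees with vertex set $[n]=\{1,\dots,n\}$ (so $\mathcal T(0)=\emptyset$), and for $T\in\mathcal T(n)$ let $\mathrm{In}(T,i)$ be the set of vertices $j$ whose edge towards the root ends at $i$. For $T\in\mathcal T(n)$, $S\in\mathcal T(m)$, $1\le i\le n$ and a map $f:\mathrm{In}(T,i)\to[m]$, let $T\circ_i^f S\in\mathcal T(n+m-1)$ be the tree obtained by substituting $S$ for the vertex $i$ of $T$: the outgoing edge of $i$, if there is one, becomes the outgoing edge of the root of $S$, each $j\in\mathrm{In}(T,i)$ is grafted on the vertex $f(j)$ of $S$, the labels of $S$ are raised by $i-1$, and the labels of $T$ greater than $i$ are raised by $m-1$. A non-symmetric operad over $\mathbf k$ consists of vector spaces $\mathcal P(n)$, $n\ge 0$, an element $1\in\mathcal P(1)$ and bilinear maps $\circ_i:\mathcal P(n)\times\mathcal P(m)\to\mathcal P(n+m-1)$, $1\le i\le n$, such that, for $a\in\mathcal P(n)$, $b\in\mathcal P(m)$, $c\in\mathcal P(\ell)$, $$(a\circ_i b)\circ_{i+j-1}c=a\circ_i(b\circ_j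 c)\ (1\le j\le m),\qquad (a\circ_i b)\circ_j c=(a\circ_j c)\circ_{i+\ell-1}b\ (j<i),\qquad 1\circ_1 a=a=a\circ_i 1 .$$ It is reduced if $\mathcal P(0)=0$ and $c\mapsto c\cdot 1$ is a bijection $\mathbf k\to\mathcal P(1)$. Morphisms are families of linear maps that preserve $1$ and all $\circ_i$. The pre-Lie operad, with its symmetric group actions forgotten, is the collection $\mathcal{PL}(n)=\mathbf k\mathcal T(n)$ with unit the one-vertex tree and composition given on trees by $T\circ_i S=\sum_{f:\mathrm{In}(T,i)\to[m]}T\circ_i^f S$. Let $f_{\mathrm{Max}}:\mathrm{In}(T,i)\to[m]$ be the map with $f_{\mathrm{Max}}(j)=m$ for $j<i$ and $f_{\mathrm{Max}}(j)=1$ for $j>i$. A tree with at least two vertices is called $\mathcal T_{\mathrm{Max}}$-indecomposable if it is not of the form $T\circ_i^{f_{\mathrm{Max}}}S$ with trees $T,S$ that both have at least two vertices. **Theorem.** $\mathcal{PL}$ is a reduced non-symmetric operad, and it is the free non-symmetric operad on the $\mathcal T_{\mathrm{Max}}$-indecomposable trees: for every non-symmetric operad $\mathcal Q$ over $\mathbf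 k$ and every choice of an element $g(X)\in\mathcal Q(n)$ for each $n$ and each $\mathcal T_{\mathrm{Max}}$-indecomposable tree $X\in\mathcal T(n)$, there is a unique morphism of non-symmetric operads $\varphi:\mathcal{PL}\to\mathcal Q$ with $\varphi(X)=g(X)$ for all such $X$. -/

import Mathlib

universe u v w

/-! ### Labelled rooted trees -/

/-- A rooted tree with vertex set `V`, all edges oriented towards the root: `parent x` is the
outgoing vertex of `x` (`none` exactly at the root), and every vertex is joined to the root by an
oriented path. With `V = Fin n` these are the `n`-labelled rooted trees; the label `j` of the usual
convention `{1, …, n}` is `j - 1` here. -/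
@[ext]
structure LabelledTree (V : Type u) where
  parent : V → Option V
  root : V
  parent_root : parent root = none
  reaches : ∀ x, Relation.ReflTransGen (fun a b => parent a = some b) x root

namespace LabelledTree

variable {V : Type u} {W : Type v}

/-- The set of incoming vertices of the vertex `i`. -/
abbrev In (T : LabelledTree V) (i : V) : Type u := {j : V // T.parent j = some i}

/-- Transport of a rooted tree along a bijection of the labels. -/
def relabel (T : LabelledTree V) (e : V ≃ W) : LabelledTree W where
  parent x := (T.parent (e.symm x)).map e
  root := e T.root
  parent_root := by simp [T.parent_root]
  reaches x := by
    have h := Relation.ReflTransGen.lift (p := fun a b => (T.parent (e.symm a)).map e = some b) e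
      (fun a b (hab : T.parent a = some b) => by simp [Function.onFun, hab]) _ _ (T.reaches (e.symm x))
    simpa [Function.onFun] using h

/-- A vertex `b` of `T` seen in the tree obtained by substituting `S` for the vertex `i` of `T`;
the vertex `i` itself is sent to the root of `S`. -/
def outer [DecidableEq V] (i : V) (S : LabelledTree W) (b : V) : {a : V // a ≠ i} ⊕ W :=
  if h : b = i then Sum.inr S.root else Sum.inl ⟨b, h⟩

/-- The tree obtained from `T` by substituting the tree `S` for the vertex `i`: the outgoing vertex
of `i`, if there is one, becomes the outgoing vertex of the root of `S`, and each incoming vertex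
`j` of `i` is grafted on the vertex `f j` of `S`. -/
def substitute [DecidableEq V] (T : LabelledTree V) (i : V) (S : LabelledTree W) (f : T.In i → W) :
    LabelledTree ({a : V // a ≠ i} ⊕ W) where
  parent x := match x with
    | Sum.inl a =>
        if h : T.parent a = some i then some (Sum.inr (f ⟨a, h⟩))
        else (T.parent a).map (outer i S)
    | Sum.inr s =>
        match S.parent s with
        | some s' => some (Sum.inr s')
        | none => (T.parent i).map (outer i S)
  root := outer i S T.root
  parent_root := by
    by_cases h : T.root = i
    · have h1 : T.parent i = none := h ▸ T.parent_root
      simp [outer, h, S.parent_root, h1]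
    · simp [outer, h, T.parent_root]
  reaches := by
    set r : ({a : V // a ≠ i} ⊕ W) → ({a : V // a ≠ i} ⊕ W) → Prop := _
    change ∀ x, Relation.ReflTransGen r x _
    have hin : ∀ s, Relation.ReflTransGen r (Sum.inr s) (Sum.inr S.root) := fun s =>
      Relation.ReflTransGen.lift (p := r) Sum.inr
        (fun a b (hab : S.parent a = some b) => by simp [r, Function.onFun, hab]) _ _ (S.reaches s)
    have hout : ∀ b, Relation.ReflTransGen r (outer i S b) (outer i S T.root) := by
      intro b
      induction T.reaches b using Relation.ReflTransGen.head_induction_on with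
      | refl => exact Relation.ReflTransGen.refl
      | @head a c hac _ ih =>
        replace hac : T.parent a = some c := hac
        by_cases ha : a = i
        · subst ha
          refine Relation.ReflTransGen.head ?_ ih
          simp [r, outer, S.parent_root, hac]
        · by_cases hc : c = i
          · subst hc
            have h1 : r (outer c S a) (Sum.inr (f ⟨a, hac⟩)) := by
              simp [r, outer, ha, hac]
            refine Relation.ReflTransGen.head h1 ((hin _).trans ?_)
            simpa [outer] using ih
          · refine Relation.ReflTransGen.head ?_ ih
            simp [r, outer, ha, hac, hc]
    rintro (a | s)
    · simpa [outer, a.2] using hout a.1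
    · exact (hin s).trans (by simpa [outer] using hout i)

end LabelledTree

/-- The labelling of a substitution: the labels of the inner tree are shifted to the block
`i, …, i + m - 1`, and the labels of the outer tree greater than `i` are raised by `m - 1`.
(Labels start at `0`.) -/
def blockEquiv {n m p : ℕ} (h : n + m = p + 1) (i : Fin n) :
    {a : Fin n // a ≠ i} ⊕ Fin m ≃ Fin p where
  toFun x := match x with
    | Sum.inl a =>
        if ha : a.1 < i then ⟨a.1, by omega⟩
        else ⟨a.1 + m - 1, by
          have := a.1.2
          have := Fin.val_ne_of_ne a.2
          have : ¬ a.1.1 < i.1 := ha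
          omega⟩
    | Sum.inr s => ⟨i + s, by omega⟩
  invFun x :=
    if h1 : x.1 < i then Sum.inl ⟨⟨x, by omega⟩, fun e => by simp [← e] at h1⟩
    else if h2 : x.1 < i + m then Sum.inr ⟨x - i, by omega⟩
    else Sum.inl ⟨⟨x + 1 - m, by omega⟩, fun e => by
      have := congrArg Fin.val e
      simp at this
      omega⟩
  left_inv := by
    rintro (⟨⟨a, ha⟩, hai⟩ | ⟨s, hs⟩)
    · have hai' : a ≠ i.1 := fun e => hai (Fin.ext e)
      by_cases hlt : a < i.1
      · simp [Fin.lt_def, hlt]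
      · have h1 : ¬ a + m - 1 < i.1 := by omega
        have h2 : ¬ a + m - 1 < i.1 + m := by omega
        simp only [Fin.lt_def, hlt, h1, h2, dite_false, Sum.inl.injEq, Subtype.mk.injEq,
          Fin.mk.injEq]
        omega
    · simp [hs]
  right_inv := by
    rintro ⟨x, hx⟩
    by_cases h1 : x < i.1
    · simp [Fin.lt_def, h1]
    · by_cases h2 : x < i.1 + m
      · simp only [h1, h2, dite_false, dite_true, Fin.mk.injEq]
        omega
      · have h3 : ¬ x + 1 - m < i.1 := by omega
        simp only [h1, h2, Fin.lt_def, h3, dite_false, Fin.mk.injEq]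
        omega

namespace LabelledTree

variable {n m p : ℕ}

/-- The `p`-labelled rooted tree `T ∘_i^f S`, where `p = n + m - 1`. -/
def compAlong (h : n + m = p + 1) (T : LabelledTree (Fin n)) (i : Fin n) (S : LabelledTree (Fin m))
    (f : T.In i → Fin m) : LabelledTree (Fin p) :=
  (T.substitute i S f).relabel (blockEquiv h i)

/-- The map `f_Max`: the incoming vertices smaller than `i` go to the largest vertex of `S`, those
greater than `i` to the smallest vertex of `S`. -/
def fMax (T : LabelledTree (Fin n)) (i : Fin n) (S : LabelledTree (Fin m)) (j : T.In i) : Fin m :=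
  if j.1 < i then ⟨m - 1, by have := S.root.2; omega⟩ else ⟨0, by have := S.root.2; omega⟩

/-- The composition of the operad `T_Max`. -/
def maxComp (h : n + m = p + 1) (T : LabelledTree (Fin n)) (i : Fin n) (S : LabelledTree (Fin m)) :
    LabelledTree (Fin p) :=
  T.compAlong h i S (T.fMax i S)

/-- `X` is the result of a non-trivial composition in the operad `T_Max`. -/
def IsDecomposable (X : LabelledTree (Fin p)) : Prop :=
  ∃ (n m : ℕ) (h : n + m = p + 1) (T : LabelledTree (Fin n)) (i : Fin n) (S : LabelledTree (Fin m)),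
    1 < n ∧ 1 < m ∧ X = T.maxComp h i S

end LabelledTree

/-- The `T_Max`-indecomposable trees with `n ≥ 2` vertices. (The tree with one vertex is the unit
of `T_Max`; it is not counted as an indecomposable.) -/
def IndecomposableTree (n : ℕ) : Type :=
  {X : LabelledTree (Fin n) // 2 ≤ n ∧ ¬ X.IsDecomposable}

/-! ### Non-symmetric operads -/

/-- The data of a non-symmetric operad over `k`: graded vector space, unit and (bilinear) partial
compositions. `comp h i a b` is `a ∘_{i+1} b`; the arity `p = n + m - 1` of the result is
given by the equation `h`. The laws are in `OperadData.IsOperad`. -/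
structure OperadData (k : Type u) [Field k] where
  obj : ℕ → Type w
  [addCommGroup : ∀ n, AddCommGroup (obj n)]
  [module : ∀ n, Module k (obj n)]
  one : obj 1
  comp : ∀ {n m p : ℕ}, n + m = p + 1 → Fin n → obj n →ₗ[k] obj m →ₗ[k] obj p

attribute [instance] OperadData.addCommGroup OperadData.module

namespace OperadData

variable {k : Type u} [Field k]

/-- The laws of a non-symmetric operad. -/
structure IsOperad (P : OperadData.{u, w} k) : Prop where
  /-- `(a ∘_i b) ∘_{i+j-1} c = a ∘_i (b ∘_j c)` in the numbering from `1`. -/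
  assoc : ∀ {n m l p q r : ℕ} (hp : n + m = p + 1) (hr : p + l = r + 1)
    (hq : m + l = q + 1) (hr' : n + q = r + 1) (i : Fin n) (j : Fin m)
    (a : P.obj n) (b : P.obj m) (c : P.obj l),
    P.comp hr ⟨i + j, by omega⟩ (P.comp hp i a b) c = P.comp hr' i a (P.comp hq j b c)
  /-- `(a ∘_i b) ∘_j c = (a ∘_j c) ∘_{i+l-1} b` for `j < i` and `c` of arity `l`. -/
  comm : ∀ {n m l p q r : ℕ} (hp : n + m = p + 1) (hr : p + l = r + 1)
    (hq : n + l = q + 1) (hr' : q + m = r + 1) (i j : Fin n) (hji : j.1 < i.1)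
    (a : P.obj n) (b : P.obj m) (c : P.obj l),
    P.comp hr ⟨j, by omega⟩ (P.comp hp i a b) c =
      P.comp hr' ⟨i + l - 1, by omega⟩ (P.comp hq j a c) b
  one_comp : ∀ {n : ℕ} (h : 1 + n = n + 1) (a : P.obj n), P.comp h 0 P.one a = a
  comp_one : ∀ {n : ℕ} (h : n + 1 = n + 1) (i : Fin n) (a : P.obj n), P.comp h i a P.one = a

/-- An operad is reduced if `P(0) = 0` and `P(1) = k`. -/
structure IsReduced (P : OperadData.{u, w} k) : Prop where
  zero : Subsingleton (P.obj 0)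
  one : Function.Bijective (fun c : k => c • P.one)

/-- Morphisms of non-symmetric operads. -/
@[ext]
structure Hom (P : OperadData.{u, v} k) (Q : OperadData.{u, w} k) where
  app : ∀ n, P.obj n →ₗ[k] Q.obj n
  map_one : app 1 P.one = Q.one
  map_comp : ∀ {n m p : ℕ} (h : n + m = p + 1) (i : Fin n) (a : P.obj n) (b : P.obj m),
    app p (P.comp h i a b) = Q.comp h i (app n a) (app m b)

/-- `P` is a non-symmetric operad, and it is free on the family `ι` of its elements: every family of
elements of the same arities in a non-symmetric operad `Q` is the image of `ι` under exactly one
morphism of operads from `P` to `Q`. Equivalently, `P` is the free operad on the graded vector space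
with basis `X`. -/
def IsFreeOn (P : OperadData.{u, u} k) {X : ℕ → Type} (ι : ∀ n, X n → P.obj n) : Prop :=
  P.IsOperad ∧ ∀ Q : OperadData.{u, w} k, Q.IsOperad → ∀ g : ∀ n, X n → Q.obj n,
    ∃! φ : Hom P Q, ∀ n (x : X n), φ.app n (ι n x) = g n x

end OperadData

/-- The pre-Lie operad as a non-symmetric operad: the arity-`n` part has the `n`-labelled rooted
trees as a basis, and `T ∘_i S` is the sum of the trees `T ∘_i^f S` over all maps `f` from the
incoming vertices of `i` to the vertices of `S`. -/
noncomputable def preLie (k : Type u) [Field k] : OperadData.{u, u} k where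
  obj n := LabelledTree (Fin n) →₀ k
  one := Finsupp.single ⟨fun _ => none, 0, rfl, fun x => by
    rw [Subsingleton.elim x 0]⟩ 1
  comp {n m p} h i :=
    Finsupp.linearCombination k fun T : LabelledTree (Fin n) =>
      Finsupp.linearCombination k fun S : LabelledTree (Fin m) =>
        ∑ f : T.In i → Fin m, Finsupp.single (T.compAlong h i S f) 1

/-! A tree X has the form T ∘_i^f S exactly when its restriction to the block i, …, i + m - 1 of
labels is S and the contraction of that block is T (`IsComp`); then f is unique. Since X and the
block determine T and S, a composition in the pre-Lie operad is a sum without multiplicities over a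
set of trees. The operad laws become statements about restricting to, and contracting, nested or
disjoint blocks (`exists_isComp_assoc`, `exists_isComp_comm`).

Freeness is a triangularity argument. Put X ≤ Y if the parent of each vertex in X lies between that
vertex and its parent in Y. The composite in T_Max is then the largest term of T ∘_i S
(`IsComp.le`). Hence the value of a morphism on a decomposable X is forced by its values in smaller
arities and on smaller trees of the same arity, which gives uniqueness.

For existence, the same recursion is run with one chosen decomposition of each decomposable tree. It
remains to see that every other composition with leading term X is preserved as well. The blocks of
two decompositions of X in T_Max are nested or disjoint, never properly overlapping
(`IsComp.not_overlap`). So the two compositions are two bracketings of one triple composition. By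
induction the lower terms contribute no defect, and the operad laws show that both compositions have
the same defect (`defect_eq`), which is zero for the chosen one. -/

namespace LabelledTree

variable {n m p : ℕ}

/-! ### Trees as edge relations on natural numbers -/

/-- The edges of a tree on `Fin n`, as a relation between natural numbers. -/
def Edge (X : LabelledTree (Fin n)) (x y : ℕ) : Prop :=
  ∃ (hx : x < n) (hy : y < n), X.parent ⟨x, hx⟩ = some ⟨y, hy⟩

theorem Edge.lt_left {X : LabelledTree (Fin n)} {x y : ℕ} (h : X.Edge x y) : x < n := h.1

theorem Edge.lt_right {X : LabelledTree (Fin n)} {x y : ℕ} (h : X.Edge x y) : y < n := h.2.1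

theorem Edge.unique {X : LabelledTree (Fin n)} {x y z : ℕ} (h : X.Edge x y) (h' : X.Edge x z) :
    y = z := by
  obtain ⟨h1, h2, h3⟩ := h
  obtain ⟨h4, h5, h6⟩ := h'
  rw [h3] at h6
  simpa using h6

theorem edge_iff (X : LabelledTree (Fin n)) (x y : Fin n) :
    X.Edge x y ↔ X.parent x = some y := by
  simp [Edge]

theorem not_edge_root (X : LabelledTree (Fin n)) (y : ℕ) : ¬ X.Edge X.root y := by
  rintro ⟨h1, h2, h3⟩
  simp [X.parent_root] at h3

/-- A set of vertices that is closed under passing to the parent and is not empty contains the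
root. -/
theorem root_mem_of_closed (X : LabelledTree (Fin n)) (C : ℕ → Prop)
    (hC : ∀ a b, X.Edge a b → C a → C b) {x : ℕ} (hx : x < n) (h : C x) : C X.root := by
  have key : ∀ a : Fin n, C a → C X.root := by
    intro a
    induction X.reaches a using Relation.ReflTransGen.head_induction_on with
    | refl => exact id
    | @head a c hac _ ih => exact fun ha => ih (hC a c ((X.edge_iff a c).2 hac) ha)
  exact key ⟨x, hx⟩ h

theorem exists_edge (X : LabelledTree (Fin n)) {x : ℕ} (hx : x < n) (h : x ≠ X.root) :
    ∃ y, X.Edge x y := by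
  by_contra hne
  push Not at hne
  refine h (X.root_mem_of_closed (fun a => x = a) ?_ hx rfl)
  rintro a b hab rfl
  exact absurd hab (hne b)

/-- With a loop at x, the set {x} would be closed under parents, so x would be the root, which has
no parent. -/
theorem Edge.ne {X : LabelledTree (Fin n)} {x y : ℕ} (h : X.Edge x y) : x ≠ y := by
  rintro rfl
  have := X.root_mem_of_closed (fun a => x = a)
    (fun a b hab e => by subst e; exact h.unique hab) h.lt_left rfl
  rw [this] at h
  exact X.not_edge_root _ h

/-- A tree is determined by its edges; an inclusion is enough. -/
theorem ext_of_edge_imp {X Y : LabelledTree (Fin n)} (h : ∀ x y, X.Edge x y → Y.Edge x y) :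
    X = Y := by
  have hr : X.root = Y.root := by
    by_contra hne
    obtain ⟨y, hy⟩ := X.exists_edge Y.root.2 (fun e => hne (Fin.ext e.symm))
    exact Y.not_edge_root y (h _ _ hy)
  refine LabelledTree.ext (funext fun x => ?_) hr
  by_cases hx : x = X.root
  · rw [hx, X.parent_root, hr, Y.parent_root]
  · obtain ⟨y, hy⟩ := X.exists_edge x.2 (fun e => hx (Fin.ext e))
    have h1 := (X.edge_iff x ⟨y, hy.lt_right⟩).1 hy
    have h2 := (Y.edge_iff x ⟨y, hy.lt_right⟩).1 (h _ _ hy)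
    rw [h1, h2]

/-- A relation in which all vertices are joined to a root is the edge relation of a tree. -/
theorem exists_of_edge_rel (E : ℕ → ℕ → Prop) (r : ℕ) (hr : r < n)
    (hlt : ∀ x y, E x y → x < n ∧ y < n) (huniq : ∀ x y z, E x y → E x z → y = z)
    (hroot : ∀ y, ¬ E r y) (hreach : ∀ x, x < n → Relation.ReflTransGen E x r) :
    ∃ X : LabelledTree (Fin n), ∀ x y, X.Edge x y ↔ E x y := by
  classical
  have hpar : ∀ x y : Fin n, (if h : ∃ y : Fin n, E x y then some h.choose else none) = some y ↔
      E x y := by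
    intro x y
    constructor
    · intro h
      split_ifs at h with hx
      simp only [Option.some.injEq] at h
      rw [← h]
      exact hx.choose_spec
    · intro h
      have hx : ∃ y : Fin n, E x y := ⟨y, h⟩
      rw [dif_pos hx, Option.some.injEq]
      exact Fin.ext (huniq _ _ _ hx.choose_spec h)
  let X : LabelledTree (Fin n) :=
    { parent := fun x => if h : ∃ y : Fin n, E x y then some h.choose else none
      root := ⟨r, hr⟩
      parent_root := dif_neg (by rintro ⟨y, hy⟩; exact hroot _ hy)
      reaches := by
        intro x
        have key : ∀ a, Relation.ReflTransGen E a r → ∀ ha : a < n,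
            Relation.ReflTransGen (fun a b : Fin n =>
              (if h : ∃ y : Fin n, E a y then some h.choose else none) = some b)
              ⟨a, ha⟩ ⟨r, hr⟩ := by
          intro a h
          induction h using Relation.ReflTransGen.head_induction_on with
          | refl => exact fun _ => Relation.ReflTransGen.refl
          | @head a c hac _ ih =>
            exact fun ha => Relation.ReflTransGen.head
              ((hpar ⟨a, ha⟩ ⟨c, (hlt _ _ hac).2⟩).2 hac) (ih _)
        exact key x (hreach x x.2) x.2 }
  refine ⟨X, fun x y => ⟨?_, fun h => ?_⟩⟩
  · rintro ⟨hx, hy, h⟩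
    exact (hpar ⟨x, hx⟩ ⟨y, hy⟩).1 h
  · exact ⟨(hlt _ _ h).1, (hlt _ _ h).2, (hpar ⟨x, _⟩ ⟨y, _⟩).2 h⟩

/-! ### Restriction to a block of labels and its contraction -/

/-- The contraction of the block `i, …, i + m - 1` of labels to the label `i`. -/
def contr (i m x : ℕ) : ℕ := if x < i then x else if x < i + m then i else x + 1 - m

/-- The three cases as linear facts for `omega`, which carries out all the label arithmetic below.
-/
theorem contr_spec (i m x : ℕ) :
    (x < i ∧ contr i m x = x) ∨ (i ≤ x ∧ x < i + m ∧ contr i m x = i) ∨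
      (i + m ≤ x ∧ contr i m x = x + 1 - m) := by
  unfold contr
  split_ifs <;> omega

/-- The tree `X` restricts to `S` on the block of labels `i, …, i + m - 1`, and the contraction of
that block to a vertex gives `T`. -/
structure IsComp (T : LabelledTree (Fin n)) (i : ℕ) (S : LabelledTree (Fin m))
    (X : LabelledTree (Fin p)) : Prop where
  arity : n + m = p + 1
  lt : i < n
  inner : ∀ s t, s < m → t < m → (S.Edge s t ↔ X.Edge (i + s) (i + t))
  -- The condition a ≠ b discards the edges inside the block, which contract to loops.
  outer : ∀ a b, T.Edge a b ↔
    a ≠ b ∧ ∃ x y, X.Edge x y ∧ contr i m x = a ∧ contr i m y = b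

theorem IsComp.unique {T T' : LabelledTree (Fin n)} {i : ℕ} {S S' : LabelledTree (Fin m)}
    {X : LabelledTree (Fin p)} (h : T.IsComp i S X) (h' : T'.IsComp i S' X) : T = T' ∧ S = S' :=
  ⟨ext_of_edge_imp fun x y hxy => (h'.outer x y).2 ((h.outer x y).1 hxy),
    ext_of_edge_imp fun x y hxy => (h'.inner x y hxy.lt_left hxy.lt_right).2
      ((h.inner x y hxy.lt_left hxy.lt_right).1 hxy)⟩

/-- At most one vertex of the block `i, …, i + m - 1` has no parent in the block. -/
def Conn (X : LabelledTree (Fin p)) (i m : ℕ) : Prop :=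
  ∀ x x', i ≤ x → x < i + m → i ≤ x' → x' < i + m →
    (∀ y, X.Edge x y → ¬ (i ≤ y ∧ y < i + m)) → (∀ y, X.Edge x' y → ¬ (i ≤ y ∧ y < i + m)) → x = x'

/-- Every other vertex of S has a parent in S, so its copy in X has its parent in the block. -/
theorem IsComp.eq_root {T : LabelledTree (Fin n)} {i : ℕ} {S : LabelledTree (Fin m)}
    {X : LabelledTree (Fin p)} (h : T.IsComp i S X) {x : ℕ} (h1 : i ≤ x) (h2 : x < i + m)
    (h3 : ∀ y, X.Edge x y → ¬ (i ≤ y ∧ y < i + m)) : x = i + S.root := by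
  by_contra hne
  obtain ⟨t, ht⟩ := S.exists_edge (x := x - i) (by omega) (by omega)
  have h4 := (h.inner _ _ ht.lt_left ht.lt_right).1 ht
  rw [Nat.add_sub_cancel' h1] at h4
  have := ht.lt_right
  exact h3 _ h4 (by omega)

theorem IsComp.conn {T : LabelledTree (Fin n)} {i : ℕ} {S : LabelledTree (Fin m)}
    {X : LabelledTree (Fin p)} (h : T.IsComp i S X) : X.Conn i m :=
  fun _ _ h1 h2 h1' h2' h3 h3' => (h.eq_root h1 h2 h3).trans (h.eq_root h1' h2' h3').symm

/-- Otherwise the block would be closed under parents and contain the root of X, which has no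
parent. -/
theorem exists_exit (X : LabelledTree (Fin p)) {i m : ℕ} (hm : 0 < m) (hp : i + m ≤ p) :
    ∃ r, i ≤ r ∧ r < i + m ∧ ∀ y, X.Edge r y → ¬ (i ≤ y ∧ y < i + m) := by
  by_contra! hne
  have := X.root_mem_of_closed (fun a => i ≤ a ∧ a < i + m)
    (fun a b hab h => by
      obtain ⟨y, hy, hy'⟩ := hne a h.1 h.2
      rwa [hab.unique hy]) (x := i) (by omega) (by omega)
  obtain ⟨y, hy, -⟩ := hne _ this.1 this.2
  exact X.not_edge_root y hy

/-- A connected block can be restricted to and contracted. -/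
theorem Conn.exists_isComp {X : LabelledTree (Fin p)} {i : ℕ} (hX : X.Conn i m)
    (h : n + m = p + 1) (hi : i < n) (hm : 0 < m) :
    ∃ (T : LabelledTree (Fin n)) (S : LabelledTree (Fin m)), T.IsComp i S X := by
  obtain ⟨r, hr1, hr2, hr3⟩ := X.exists_exit (i := i) hm (by omega)
  have hexit : ∀ x, i ≤ x → x < i + m → (∀ y, X.Edge x y → ¬ (i ≤ y ∧ y < i + m)) → x = r :=
    fun x h1 h2 h3 => hX x r h1 h2 hr1 hr2 h3 hr3
  obtain ⟨S, hS⟩ := exists_of_edge_rel (n := m)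
    (fun s t => s < m ∧ t < m ∧ X.Edge (i + s) (i + t)) (r - i) (by omega)
    (fun x y h => ⟨h.1, h.2.1⟩)
    (fun x y z h h' => by have := h.2.2.unique h'.2.2; omega)
    (fun y h => hr3 (i + y) (by simpa [Nat.add_sub_cancel' hr1] using h.2.2) (by omega))
    (by
      -- A path of X towards the root can leave the block only at r, so its part before that joins a
      -- to r inside the block.
      have key : ∀ a : Fin p, i ≤ a.1 → a.1 < i + m → Relation.ReflTransGen
          (fun s t => s < m ∧ t < m ∧ X.Edge (i + s) (i + t)) (a - i) (r - i) := by
        intro a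
        induction X.reaches a using Relation.ReflTransGen.head_induction_on with
        | refl =>
          intro h1 h2
          rw [hexit _ h1 h2 fun y hy => absurd hy (X.not_edge_root y)]
        | @head a c hac _ ih =>
          intro h1 h2
          have hac' := (X.edge_iff a c).2 hac
          by_cases hc : i ≤ c.1 ∧ c.1 < i + m
          · refine Relation.ReflTransGen.head ⟨by omega, by omega, ?_⟩ (ih hc.1 hc.2)
            rwa [Nat.add_sub_cancel' h1, Nat.add_sub_cancel' hc.1]
          · rw [hexit _ h1 h2 fun y hy => by rwa [← hac'.unique hy]]
      intro x hx
      simpa using key ⟨i + x, by omega⟩ (by simp) (by simpa using hx))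
  obtain ⟨T, hT⟩ := exists_of_edge_rel (n := n)
    (fun a b => a ≠ b ∧ ∃ x y, X.Edge x y ∧ contr i m x = a ∧ contr i m y = b)
    (contr i m X.root) (by have := contr_spec i m X.root; omega)
    (by
      rintro a b ⟨-, x, y, hxy, rfl, rfl⟩
      have := contr_spec i m x
      have := contr_spec i m y
      have := hxy.lt_left
      have := hxy.lt_right
      omega)
    (by
      rintro a b c ⟨hab, x, y, hxy, rfl, rfl⟩ ⟨hac, x', y', hxy', hxx', rfl⟩
      have hx := contr_spec i m x
      have hx' := contr_spec i m x'
      have hy := contr_spec i m y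
      have hy' := contr_spec i m y'
      -- Outside the block contraction is injective; inside, both edges leave the block and hence
      -- start at its unique exit.
      have : x = x' := by
        by_cases hb : i ≤ x ∧ x < i + m
        · exact hX x x' hb.1 hb.2 (by omega) (by omega)
            (fun z hz => by rw [← hxy.unique hz]; omega)
            (fun z hz => by rw [← hxy'.unique hz]; omega)
        · omega
      subst this
      rw [hxy.unique hxy'])
    (by
      rintro b ⟨hab, x, y, hxy, hx, rfl⟩
      have h1 := contr_spec i m x
      have h2 := contr_spec i m X.root
      have h3 := contr_spec i m y
      have : x = X.root := by
        by_cases hb : i ≤ x ∧ x < i + m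
        · exact hX x X.root hb.1 hb.2 (by omega) (by omega)
            (fun z hz => by rw [← hxy.unique hz]; omega)
            (fun z hz => absurd hz (X.not_edge_root z))
        · omega
      subst this
      exact X.not_edge_root _ hxy)
    (by
      have key : ∀ a : Fin p, Relation.ReflTransGen
          (fun a b => a ≠ b ∧ ∃ x y, X.Edge x y ∧ contr i m x = a ∧ contr i m y = b)
          (contr i m a) (contr i m X.root) := by
        intro a
        induction X.reaches a using Relation.ReflTransGen.head_induction_on with
        | refl => exact Relation.ReflTransGen.refl
        | @head a c hac _ ih =>
          by_cases he : contr i m a = contr i m c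
          · rwa [he]
          · exact Relation.ReflTransGen.head
              ⟨he, a, c, (X.edge_iff a c).2 hac, rfl, rfl⟩ ih
      intro a ha
      -- Preimages of a under contraction: a itself below i, and a + m - 1 from i on.
      have h1 := contr_spec i m a
      have h2 := contr_spec i m (a + m - 1)
      by_cases hai : a < i
      · have := key ⟨a, by omega⟩
        rwa [show contr i m a = a by omega] at this
      · have := key ⟨a + m - 1, by omega⟩
        rwa [show contr i m (a + m - 1) = a by omega] at this)
  exact ⟨T, S, h, hi, fun s t hs ht => by simp [hS, hs, ht], fun a b => hT a b⟩

end LabelledTree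

/-! ### Grafting maps correspond to the trees satisfying `IsComp` -/

theorem blockEquiv_inl_val {n m p : ℕ} (h : n + m = p + 1) (i : Fin n) (a : {a : Fin n // a ≠ i}) :
    (blockEquiv h i (Sum.inl a)).1 = if a.1.1 < i.1 then a.1.1 else a.1.1 + m - 1 := by
  by_cases ha : a.1 < i
  · have ha' : a.1.1 < i.1 := ha
    simp [blockEquiv, ha]
  · have ha' : ¬ a.1.1 < i.1 := ha
    simp [blockEquiv, ha, -not_lt]

theorem blockEquiv_inr_val {n m p : ℕ} (h : n + m = p + 1) (i : Fin n) (s : Fin m) :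
    (blockEquiv h i (Sum.inr s)).1 = i + s := rfl

namespace LabelledTree

variable {n m p : ℕ}

theorem relabel_parent {V : Type u} {W : Type v} (T : LabelledTree V) (e : V ≃ W) (x : V) :
    (T.relabel e).parent (e x) = (T.parent x).map e := by
  simp [relabel]

section compAlong

variable (h : n + m = p + 1) (T : LabelledTree (Fin n)) (i : Fin n) (S : LabelledTree (Fin m))
  (f : T.In i → Fin m)

/-- The first of four kinds of edges: inside S, from a child of i, between other vertices of T, and
from the root of S. Producing them is enough, since parents are unique. -/
theorem compAlong_edge_inner {s t : ℕ} (hst : S.Edge s t) :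
    (T.compAlong h i S f).Edge (i + s) (i + t) := by
  obtain ⟨hs, ht, hst⟩ := hst
  have := relabel_parent (T.substitute i S f) (blockEquiv h i) (Sum.inr ⟨s, hs⟩)
  simp only [substitute, hst, Option.map_some] at this
  exact (edge_iff _ _ _).2 this

theorem compAlong_edge_graft (j : T.In i) :
    (T.compAlong h i S f).Edge (if j.1.1 < i.1 then j.1.1 else j.1.1 + m - 1) (i + f j) := by
  have hne : j.1 ≠ i := fun e => ((T.edge_iff j.1 i).2 j.2).ne (congrArg Fin.val e)
  have := relabel_parent (T.substitute i S f) (blockEquiv h i) (Sum.inl ⟨j.1, hne⟩)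
  simp only [substitute, j.2, dite_true, Option.map_some] at this
  have := (edge_iff _ _ _).2 this
  rwa [blockEquiv_inl_val, blockEquiv_inr_val] at this

theorem compAlong_edge_outer {a b : ℕ} (hab : T.Edge a b) (ha : a ≠ i) (hb : b ≠ i) :
    (T.compAlong h i S f).Edge (if a < i.1 then a else a + m - 1)
      (if b < i.1 then b else b + m - 1) := by
  obtain ⟨ha', hb', hab⟩ := hab
  have hb2 : (⟨b, hb'⟩ : Fin n) ≠ i := fun e => hb (congrArg Fin.val e)
  have := relabel_parent (T.substitute i S f) (blockEquiv h i)
    (Sum.inl ⟨⟨a, ha'⟩, fun e => ha (congrArg Fin.val e)⟩)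
  simp only [substitute, hab, Option.some.injEq, hb2, dite_false, Option.map_some, outer] at this
  have := (edge_iff _ _ _).2 this
  rwa [blockEquiv_inl_val, blockEquiv_inl_val] at this

theorem compAlong_edge_root {b : ℕ} (hb : T.Edge i b) :
    (T.compAlong h i S f).Edge (i + S.root) (if b < i.1 then b else b + m - 1) := by
  have hbi := hb.ne
  obtain ⟨_, hb', hab⟩ := hb
  have hne : (⟨b, hb'⟩ : Fin n) ≠ i := fun e => hbi (congrArg Fin.val e).symm
  have hsub : (T.substitute i S f).parent (Sum.inr S.root) = some (Sum.inl ⟨⟨b, hb'⟩, hne⟩) := by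
    simp only [Fin.eta] at hab
    simp only [substitute, S.parent_root, hab, hne, dite_false, Option.map_some, outer]
  have := relabel_parent (T.substitute i S f) (blockEquiv h i) (Sum.inr S.root)
  rw [hsub, Option.map_some] at this
  have := (edge_iff _ _ _).2 this
  rwa [blockEquiv_inl_val, blockEquiv_inr_val] at this

theorem compAlong_root_of_eq (hr : T.root = i) : ((T.compAlong h i S f).root : ℕ) = i + S.root := by
  simp [compAlong, relabel, substitute, outer, hr, blockEquiv_inr_val]

theorem compAlong_root_of_ne (hr : T.root ≠ i) : ((T.compAlong h i S f).root : ℕ) =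
    if T.root.1 < i.1 then T.root.1 else T.root.1 + m - 1 := by
  simp only [compAlong, relabel, substitute, outer, hr, dite_false, blockEquiv_inl_val]

theorem isComp_compAlong : T.IsComp i S (T.compAlong h i S f) := by
  have hm : 0 < m := S.root.pos
  have hi := i.2
  set X := T.compAlong h i S f with hX
  have hroot : ∀ y, X.Edge (i + S.root) y → ¬ (i ≤ y ∧ y < i + m) := by
    intro y hy hy'
    by_cases hr : T.root = i
    · rw [← compAlong_root_of_eq h T i S f hr] at hy
      exact X.not_edge_root y hy
    · obtain ⟨b, hb⟩ := T.exists_edge i.2 (fun e => hr (Fin.ext e.symm))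
      have h1 := (compAlong_edge_root h T i S f hb).unique hy
      have h2 := hb.ne
      split_ifs at h1 <;> omega
  have hin : ∀ s y, s < m → s ≠ S.root → X.Edge (i + s) y → ∃ t, S.Edge s t ∧ y = i + t := by
    intro s y hs hne hy
    obtain ⟨t, ht⟩ := S.exists_edge hs hne
    exact ⟨t, ht, hy.unique (compAlong_edge_inner h T i S f ht)⟩
  refine ⟨h, i.2, fun s t hs ht => ⟨compAlong_edge_inner h T i S f, fun hst => ?_⟩,
    fun a b => ⟨fun hab => ⟨hab.ne, ?_⟩, ?_⟩⟩
  · by_cases hsr : s = S.root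
    · subst hsr
      exact absurd ⟨by omega, by omega⟩ (hroot _ hst)
    · obtain ⟨t', ht', he⟩ := hin s _ hs hsr hst
      rwa [show t = t' by omega]
  · have hne := hab.ne
    by_cases ha : a = i
    · subst ha
      refine ⟨_, _, compAlong_edge_root h T i S f hab, ?_, ?_⟩
      · have := contr_spec i m (i + S.root)
        omega
      · have := contr_spec i m (if b < i.1 then b else b + m - 1)
        split_ifs at this ⊢ <;> omega
    · have key : contr i m (if a < i.1 then a else a + m - 1) = a := by
        have := contr_spec i m (if a < i.1 then a else a + m - 1)
        split_ifs at this ⊢ <;> omega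
      by_cases hb : b = i
      · subst hb
        refine ⟨_, _, compAlong_edge_graft h T i S f ⟨⟨a, hab.lt_left⟩,
          (T.edge_iff ⟨a, hab.lt_left⟩ i).1 hab⟩, key, ?_⟩
        generalize f _ = t
        have := contr_spec i m (i + t)
        omega
      · refine ⟨_, _, compAlong_edge_outer h T i S f hab ha hb, key, ?_⟩
        have := contr_spec i m (if b < i.1 then b else b + m - 1)
        split_ifs at this ⊢ <;> omega
  · rintro ⟨hne, x, y, hxy, hx, hy⟩
    have hx1 := hxy.lt_left
    have hy1 := hxy.lt_right
    have hxs := contr_spec i m x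
    have hys := contr_spec i m y
    have hxr : i.1 ≤ x → x < i + m → x = i + S.root := by
      intro h1 h2
      by_contra hne'
      obtain ⟨t, ht, he⟩ := hin (x - i) y (by omega) (by omega)
        (by rwa [Nat.add_sub_cancel' h1])
      have := ht.lt_right
      omega
    have hnr : a ≠ T.root := by
      rintro rfl
      by_cases hr : T.root = i
      · rw [hxr (by omega) (by omega), ← compAlong_root_of_eq h T i S f hr] at hxy
        exact X.not_edge_root y hxy
      · have h1 := compAlong_root_of_ne h T i S f hr
        have h2 : T.root.1 ≠ i.1 := fun e => hr (Fin.ext e)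
        refine X.not_edge_root y ?_
        rw [← hX] at h1
        rwa [h1, show (if T.root.1 < i.1 then T.root.1 else T.root.1 + m - 1) = x by
          split_ifs <;> omega]
    -- The parent c of a in T yields a known edge of X starting at the same x; uniqueness of parents
    -- then gives b = c.
    obtain ⟨c, hc⟩ := T.exists_edge (x := a) (by omega) hnr
    have hac := hc.ne
    suffices b = c by rwa [this]
    by_cases ha : a = i
    · subst ha
      have h1 := compAlong_edge_root h T i S f hc
      rw [← hX, ← hxr (by omega) (by omega)] at h1
      have := hxy.unique h1
      split_ifs at this <;> omega
    · have hxa : (if a < i.1 then a else a + m - 1) = x := by split_ifs <;> omega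
      by_cases hci : c = i
      · subst hci
        have h1 := compAlong_edge_graft h T i S f ⟨⟨a, hc.lt_left⟩,
          (T.edge_iff ⟨a, hc.lt_left⟩ i).1 hc⟩
        simp only [hxa] at h1
        generalize f _ = t at h1
        have := hxy.unique h1
        omega
      · have h1 := compAlong_edge_outer h T i S f hc ha hci
        rw [hxa] at h1
        have := hxy.unique h1
        split_ifs at this <;> omega

theorem compAlong_injective : Function.Injective (T.compAlong h i S) := by
  intro f g hfg
  funext j
  have h1 := compAlong_edge_graft h T i S f j
  rw [hfg] at h1
  have := h1.unique (compAlong_edge_graft h T i S g j)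
  exact Fin.ext (by omega)

end compAlong

/-- A child j of i comes from a vertex of X outside the block with its parent inside; f j is that
parent. Every edge of X is then of one of the four known kinds. -/
theorem IsComp.exists_eq_compAlong {T : LabelledTree (Fin n)} {i : Fin n}
    {S : LabelledTree (Fin m)} {X : LabelledTree (Fin p)} (hX : T.IsComp i S X) :
    ∃ f, T.compAlong hX.arity i S f = X := by
  have hm : 0 < m := S.root.pos
  have hn := hX.arity
  have hi := i.2
  have hf : ∀ j : T.In i, ∃ t : Fin m,
      X.Edge (if j.1.1 < i.1 then j.1.1 else j.1.1 + m - 1) (i + t) := by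
    rintro ⟨j, hj⟩
    have hj' := (T.edge_iff j i).2 hj
    have hne := hj'.ne
    obtain ⟨-, x, y, hxy, hx, hy⟩ := (hX.outer _ _).1 hj'
    have h1 := contr_spec i m x
    have h2 := contr_spec i m y
    refine ⟨⟨y - i, by omega⟩, ?_⟩
    convert hxy using 1
    · simp only
      split_ifs <;> omega
    · simp only
      omega
  choose f hf using hf
  refine ⟨f, (ext_of_edge_imp fun x y hxy => ?_).symm⟩
  have hx1 := hxy.lt_left
  have hy1 := hxy.lt_right
  have hxs := contr_spec i m x
  have hys := contr_spec i m y
  by_cases he : contr i m x = contr i m y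
  · have hne := hxy.ne
    have h1 := (hX.inner (x - i) (y - i) (by omega) (by omega)).2
      (by rwa [Nat.add_sub_cancel' (by omega), Nat.add_sub_cancel' (by omega)])
    have h2 := compAlong_edge_inner hn T i S f h1
    rwa [Nat.add_sub_cancel' (by omega), Nat.add_sub_cancel' (by omega)] at h2
  · have hT := (hX.outer _ _).2 ⟨he, x, y, hxy, rfl, rfl⟩
    by_cases hxi : i.1 ≤ x ∧ x < i + m
    · rw [show contr i m x = i by omega] at hT
      have h1 := compAlong_edge_root hn T i S f hT
      rw [hX.eq_root hxi.1 hxi.2 fun z hz => by rw [← hxy.unique hz]; omega]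
      convert h1 using 1
      split_ifs <;> omega
    · have hxa : (if contr i m x < i.1 then contr i m x else contr i m x + m - 1) = x := by
        split_ifs <;> omega
      by_cases hyi : i.1 ≤ y ∧ y < i + m
      · rw [show contr i m y = i by omega] at hT
        let j : T.In i := ⟨⟨contr i m x, hT.lt_left⟩, (T.edge_iff ⟨_, hT.lt_left⟩ i).1 hT⟩
        have h1 := compAlong_edge_graft hn T i S f j
        have h2 := hf j
        simp only [j, hxa] at h1 h2
        rwa [hxy.unique h2]
      · have h1 := compAlong_edge_outer hn T i S f hT (by omega) (by omega)
        rw [hxa] at h1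
        convert h1 using 1
        split_ifs <;> omega

/-! ### Maximal attachment, the mark of composites in T_Max -/

/-- The edges of `X` entering the block `i, …, i + m - 1` from the left end at its last label, and
those entering it from the right end at its first label. -/
def MaxAtt (X : LabelledTree (Fin p)) (i m : ℕ) : Prop :=
  ∀ x y, X.Edge x y → i ≤ y → y < i + m → (x < i → y + 1 = i + m) ∧ (i + m ≤ x → y = i)

theorem isComp_maxComp (h : n + m = p + 1) (T : LabelledTree (Fin n)) (i : Fin n)
    (S : LabelledTree (Fin m)) : T.IsComp i S (T.maxComp h i S) :=
  isComp_compAlong h T i S _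

/-- An edge entering the block from outside is a grafting edge, so `fMax` prescribes its end.
Together with `isComp_maxComp` this is all that is used of `maxComp` later. -/
theorem maxAtt_maxComp (h : n + m = p + 1) (T : LabelledTree (Fin n)) (i : Fin n)
    (S : LabelledTree (Fin m)) : (T.maxComp h i S).MaxAtt i m := by
  have hm : 0 < m := S.root.pos
  intro x y hxy h1 h2
  have key : ¬ (i.1 ≤ x ∧ x < i + m) →
      y = i + (if x < i.1 then m - 1 else 0) := by
    intro hx
    have hxs := contr_spec i m x
    have hys := contr_spec i m y
    have hT := ((isComp_maxComp h T i S).outer (contr i m x) i).2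
      ⟨by omega, x, y, hxy, rfl, by omega⟩
    have h3 := compAlong_edge_graft h T i S (T.fMax i S) ⟨⟨_, hT.lt_left⟩,
      (T.edge_iff ⟨_, hT.lt_left⟩ i).1 hT⟩
    have hxa : (if contr i m x < i.1 then contr i m x else contr i m x + m - 1) = x := by
      split_ifs <;> omega
    simp only [hxa] at h3
    rw [hxy.unique h3]
    simp only [fMax, Fin.lt_def]
    split_ifs <;> first | omega | rfl
  constructor <;> intro h4 <;> have := key (by omega) <;> split_ifs at this <;> omega

end LabelledTree

/-! ### Nested and disjoint blocks: associativity and parallel commutation -/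

theorem LabelledTree.contr_contr_nested {i j l m q : ℕ} (h : m + l = q + 1) (hj : j < m) (x : ℕ) :
    contr i m (contr (i + j) l x) = contr i q x := by
  have h1 := contr_spec (i + j) l x
  have h2 := contr_spec i m (contr (i + j) l x)
  have h3 := contr_spec i q x
  omega

theorem LabelledTree.contr_contr_disjoint {i k l m : ℕ} (hm : 0 < m) (hl : 0 < l) (h : i + m ≤ k)
    (x : ℕ) : contr (k + 1 - m) l (contr i m x) = contr i m (contr k l x) := by
  have h1 := contr_spec i m x
  have h2 := contr_spec (k + 1 - m) l (contr i m x)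
  have h3 := contr_spec k l x
  have h4 := contr_spec i m (contr k l x)
  omega

namespace LabelledTree

variable {n m l p q r : ℕ}

theorem IsComp.pos_right {T : LabelledTree (Fin n)} {i : ℕ} {S : LabelledTree (Fin m)}
    {X : LabelledTree (Fin p)} (_ : T.IsComp i S X) : 0 < m := S.root.pos

/-- Z has the edges of X inside the outer block, so the inner block stays connected in Z and can be
contracted there to give B; restriction to the outer block commutes with this contraction. -/
theorem IsComp.nested {A : LabelledTree (Fin n)} {Z : LabelledTree (Fin q)}
    {X : LabelledTree (Fin r)} {Y : LabelledTree (Fin p)} {C : LabelledTree (Fin l)} {i j : ℕ}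
    (hAZ : A.IsComp i Z X) (hYC : Y.IsComp (i + j) C X) (hm : m + l = q + 1) (hj : j < m) :
    ∃ B : LabelledTree (Fin m), B.IsComp j C Z ∧ A.IsComp i B Y := by
  have hl := hYC.pos_right
  have h1 := hAZ.arity
  have h2 := hYC.arity
  have hi := hAZ.lt
  have hconn : Z.Conn j l := by
    intro x x' hx1 hx2 hx1' hx2' hx hx'
    have key : ∀ x, j ≤ x → x < j + l → (∀ y, Z.Edge x y → ¬ (j ≤ y ∧ y < j + l)) →
        ∀ y, X.Edge (i + x) y → ¬ (i + j ≤ y ∧ y < i + j + l) := by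
      intro x h1 h2 h3 y hy hy'
      obtain ⟨t, rfl⟩ := Nat.exists_eq_add_of_le (show i ≤ y by omega)
      exact h3 t ((hAZ.inner _ _ (by omega) (by omega)).2 hy) (by omega)
    have := hYC.conn (i + x) (i + x') (by omega) (by omega) (by omega) (by omega)
      (key x hx1 hx2 hx) (key x' hx1' hx2' hx')
    omega
  obtain ⟨B, C', hBC⟩ := hconn.exists_isComp hm hj hl
  have hC : C' = C := ext_of_edge_imp fun s t hst => by
    have h3 := hst.lt_left
    have h4 := hst.lt_right
    have := (hAZ.inner _ _ (by omega) (by omega)).1 ((hBC.inner s t h3 h4).1 hst)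
    rw [← Nat.add_assoc, ← Nat.add_assoc] at this
    exact (hYC.inner s t h3 h4).2 this
  subst hC
  refine ⟨B, hBC, by omega, hi, fun s t hs ht => ?_, fun a b => ?_⟩
  · rw [hBC.outer, hYC.outer]
    constructor
    · rintro ⟨hne, x, y, hxy, hx, hy⟩
      have hx1 := hxy.lt_left
      have hy1 := hxy.lt_right
      have h3 := contr_spec j l x
      have h4 := contr_spec j l y
      have h5 := contr_spec (i + j) l (i + x)
      have h6 := contr_spec (i + j) l (i + y)
      exact ⟨by omega, i + x, i + y, (hAZ.inner _ _ hx1 hy1).1 hxy, by omega, by omega⟩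
    · rintro ⟨hne, x, y, hxy, hx, hy⟩
      have h5 := contr_spec (i + j) l x
      have h6 := contr_spec (i + j) l y
      obtain ⟨x, rfl⟩ := Nat.exists_eq_add_of_le (show i ≤ x by omega)
      obtain ⟨y, rfl⟩ := Nat.exists_eq_add_of_le (show i ≤ y by omega)
      have h3 := contr_spec j l x
      have h4 := contr_spec j l y
      exact ⟨by omega, x, y, (hAZ.inner _ _ (by omega) (by omega)).2 hxy, by omega, by omega⟩
  · rw [hAZ.outer]
    refine and_congr_right fun hab => ⟨?_, ?_⟩
    · rintro ⟨x, y, hxy, hx, hy⟩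
      have h3 := contr_contr_nested (i := i) hm hj x
      have h4 := contr_contr_nested (i := i) hm hj y
      refine ⟨contr (i + j) l x, contr (i + j) l y,
        (hYC.outer _ _).2 ⟨fun e => hab ?_, x, y, hxy, rfl, rfl⟩, by omega, by omega⟩
      rw [← hx, ← hy, ← h3, ← h4, e]
    · rintro ⟨x, y, hxy, hx, hy⟩
      obtain ⟨-, x', y', hxy', rfl, rfl⟩ := (hYC.outer _ _).1 hxy
      have h3 := contr_contr_nested (i := i) hm hj x'
      have h4 := contr_contr_nested (i := i) hm hj y'
      exact ⟨x', y', hxy', by omega, by omega⟩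

/-- Contracting the block at k leaves the edges between labels below k alone, so the block at i
stays connected in Y'. The two contractions commute, and contracting the first block moves the
second to k + 1 - m. -/
theorem IsComp.disjoint {Y : LabelledTree (Fin p)} {B : LabelledTree (Fin m)}
    {X : LabelledTree (Fin r)} {Y' : LabelledTree (Fin q)} {C : LabelledTree (Fin l)} {i k : ℕ}
    (hYB : Y.IsComp i B X) (hYC : Y'.IsComp k C X) (hik : i + m ≤ k) (hn : n + m = q + 1) :
    ∃ A : LabelledTree (Fin n), A.IsComp i B Y' ∧ A.IsComp (k + 1 - m) C Y := by
  have hm := hYB.pos_right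
  have hl := hYC.pos_right
  have h1 := hYB.arity
  have h2 := hYC.arity
  have hk := hYC.lt
  have hcontr : ∀ x, x < k → contr k l x = x := fun x hx => by
    have := contr_spec k l x
    omega
  have hedge : ∀ x y, x < k → y < k → (Y'.Edge x y ↔ X.Edge x y) := by
    intro x y hx hy
    rw [hYC.outer]
    constructor
    · rintro ⟨hne, x', y', hxy, hx', hy'⟩
      have h3 := contr_spec k l x'
      have h4 := contr_spec k l y'
      rwa [show x = x' by omega, show y = y' by omega]
    · exact fun h => ⟨h.ne, x, y, h, hcontr x hx, hcontr y hy⟩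
  have hconn : Y'.Conn i m := by
    intro x x' hx1 hx2 hx1' hx2' hx hx'
    exact hYB.conn x x' hx1 hx2 hx1' hx2'
      (fun y hy hy' => hx y ((hedge x y (by omega) (by omega)).2 hy) hy')
      (fun y hy hy' => hx' y ((hedge x' y (by omega) (by omega)).2 hy) hy')
  obtain ⟨A, B', hAB⟩ := hconn.exists_isComp hn (by omega) hm
  have hB : B' = B := ext_of_edge_imp fun s t hst => by
    have h3 := hst.lt_left
    have h4 := hst.lt_right
    exact (hYB.inner s t h3 h4).2 ((hedge _ _ (by omega) (by omega)).1
      ((hAB.inner s t h3 h4).1 hst))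
  subst hB
  refine ⟨A, hAB, by omega, by omega, fun s t hs ht => ?_, fun a b => ?_⟩
  · rw [hYC.inner s t hs ht, hYB.outer]
    constructor
    · intro hxy
      have hne := hxy.ne
      have h5 := contr_spec i m (k + s)
      have h6 := contr_spec i m (k + t)
      exact ⟨by omega, _, _, hxy, by omega, by omega⟩
    · rintro ⟨hne, x, y, hxy, hx, hy⟩
      have h5 := contr_spec i m x
      have h6 := contr_spec i m y
      rwa [show k + s = x by omega, show k + t = y by omega]
  · rw [hAB.outer]
    refine and_congr_right fun hab => ⟨?_, ?_⟩
    · rintro ⟨x, y, hxy, hx, hy⟩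
      obtain ⟨-, x', y', hxy', rfl, rfl⟩ := (hYC.outer _ _).1 hxy
      have h3 := contr_contr_disjoint hm hl hik x'
      have h4 := contr_contr_disjoint hm hl hik y'
      refine ⟨contr i m x', contr i m y',
        (hYB.outer _ _).2 ⟨fun e => hab ?_, x', y', hxy', rfl, rfl⟩, by omega, by omega⟩
      rw [← hx, ← hy, ← h3, ← h4, e]
    · rintro ⟨x, y, hxy, hx, hy⟩
      obtain ⟨-, x', y', hxy', rfl, rfl⟩ := (hYB.outer _ _).1 hxy
      have h3 := contr_contr_disjoint hm hl hik x'
      have h4 := contr_contr_disjoint hm hl hik y'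
      refine ⟨contr k l x', contr k l y',
        (hYC.outer _ _).2 ⟨fun e => hab ?_, x', y', hxy', rfl, rfl⟩, by omega, by omega⟩
      rw [← hx, ← hy, h3, h4, e]

/-- Associativity of the relation `IsComp`. -/
theorem exists_isComp_assoc {A : LabelledTree (Fin n)} {B : LabelledTree (Fin m)}
    {C : LabelledTree (Fin l)} {X : LabelledTree (Fin r)} {i j : ℕ} (hp : n + m = p + 1)
    (hr : p + l = r + 1) (hq : m + l = q + 1) (hi : i < n) (hj : j < m) :
    (∃ Y : LabelledTree (Fin p), A.IsComp i B Y ∧ Y.IsComp (i + j) C X) ↔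
      ∃ Z : LabelledTree (Fin q), B.IsComp j C Z ∧ A.IsComp i Z X := by
  have hl := C.root.pos
  constructor
  · rintro ⟨Y, hAB, hYC⟩
    have hconn : X.Conn i q := by
      intro x x' hx1 hx2 hx1' hx2' hx hx'
      -- An exit of the outer block in X contracts to an exit of the block of B in Y, which is
      -- unique; if it lies in the inner block, it is also the unique exit of that block.
      have key : ∀ x, i ≤ x → x < i + q → (∀ y, X.Edge x y → ¬ (i ≤ y ∧ y < i + q)) →
          i ≤ contr (i + j) l x ∧ contr (i + j) l x < i + m ∧
          (∀ y, Y.Edge (contr (i + j) l x) y → ¬ (i ≤ y ∧ y < i + m)) ∧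
          ∀ y, X.Edge x y → ¬ (i + j ≤ y ∧ y < i + j + l) := by
        intro x hx1 hx2 hx
        have h1 := contr_spec (i + j) l x
        have h2 : ∀ y, X.Edge x y → ¬ (i + j ≤ y ∧ y < i + j + l) := fun y hy => by
          have := hx y hy
          omega
        refine ⟨by omega, by omega, ?_, h2⟩
        intro b hb hb'
        obtain ⟨hne, x1, y, hxy, hx1, rfl⟩ := (hYC.outer _ _).1 hb
        have h3 := contr_spec (i + j) l x1
        have h4 := contr_spec (i + j) l y
        have : x1 = x := by
          by_cases hb : i + j ≤ x ∧ x < i + j + l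
          · refine hYC.conn x1 x (by omega) (by omega) hb.1 hb.2 ?_ h2
            intro z hz
            rw [← hxy.unique hz]
            omega
          · omega
        subst this
        have := hx y hxy
        omega
      obtain ⟨h1, h2, h3, h4⟩ := key x hx1 hx2 hx
      obtain ⟨h1', h2', h3', h4'⟩ := key x' hx1' hx2' hx'
      have h5 := hAB.conn _ _ h1 h2 h1' h2' h3 h3'
      have h6 := contr_spec (i + j) l x
      have h7 := contr_spec (i + j) l x'
      by_cases hb : i + j ≤ x ∧ x < i + j + l
      · exact hYC.conn x x' hb.1 hb.2 (by omega) (by omega) h4 h4'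
      · omega
    obtain ⟨A', Z, hAZ⟩ := hconn.exists_isComp (n := n) (by omega) hi (by omega)
    obtain ⟨B', hBC, hAB'⟩ := hAZ.nested hYC hq hj
    obtain ⟨rfl, rfl⟩ := hAB.unique hAB'
    exact ⟨Z, hBC, hAZ⟩
  · rintro ⟨Z, hBC, hAZ⟩
    have hconn : X.Conn (i + j) l := by
      intro x x' hx1 hx2 hx1' hx2' hx hx'
      have key : ∀ x, i + j ≤ x → x < i + j + l →
          (∀ y, X.Edge x y → ¬ (i + j ≤ y ∧ y < i + j + l)) →
          ∀ y, Z.Edge (x - i) y → ¬ (j ≤ y ∧ y < j + l) := by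
        intro x hx1 hx2 hx y hy
        have h1 := (hAZ.inner _ _ hy.lt_left hy.lt_right).1 hy
        rw [Nat.add_sub_cancel' (by omega)] at h1
        have := hx _ h1
        omega
      have := hBC.conn (x - i) (x' - i) (by omega) (by omega) (by omega) (by omega)
        (key x hx1 hx2 hx) (key x' hx1' hx2' hx')
      omega
    obtain ⟨Y, C', hYC⟩ := hconn.exists_isComp (n := p) hr (by omega) hl
    obtain ⟨B', hBC', hAB⟩ := hAZ.nested hYC hq hj
    obtain ⟨rfl, rfl⟩ := hBC.unique hBC'
    exact ⟨Y, hAB, hYC⟩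

/-- Parallel substitutions commute. -/
theorem exists_isComp_comm {A : LabelledTree (Fin n)} {B : LabelledTree (Fin m)}
    {C : LabelledTree (Fin l)} {X : LabelledTree (Fin r)} {i j : ℕ} (hp : n + m = p + 1)
    (hr : p + l = r + 1) (hq : n + l = q + 1) (hi : i < n) (hji : j < i) :
    (∃ Y : LabelledTree (Fin p), A.IsComp i B Y ∧ Y.IsComp j C X) ↔
      ∃ Z : LabelledTree (Fin q), A.IsComp j C Z ∧ Z.IsComp (i + l - 1) B X := by
  have hl := C.root.pos
  have hm := B.root.pos
  have hi' : i + l - 1 + 1 - l = i := by omega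
  constructor
  · rintro ⟨Y, hAB, hYC⟩
    have hconn : X.Conn (i + l - 1) m := by
      intro x x' hx1 hx2 hx1' hx2' hx hx'
      have key : ∀ x, i + l - 1 ≤ x → x < i + l - 1 + m →
          (∀ y, X.Edge x y → ¬ (i + l - 1 ≤ y ∧ y < i + l - 1 + m)) →
          ∀ y, Y.Edge (x + 1 - l) y → ¬ (i ≤ y ∧ y < i + m) := by
        intro x hx1 hx2 hx b hb
        obtain ⟨hne, x1, y, hxy, hx1, rfl⟩ := (hYC.outer _ _).1 hb
        have h3 := contr_spec j l x1
        have h4 := contr_spec j l y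
        rw [show x1 = x by omega] at hxy
        have := hx y hxy
        omega
      have := hAB.conn (x + 1 - l) (x' + 1 - l) (by omega) (by omega) (by omega) (by omega)
        (key x hx1 hx2 hx) (key x' hx1' hx2' hx')
      omega
    obtain ⟨Z, B', hZB⟩ := hconn.exists_isComp (n := q) (by omega) (by omega) hm
    obtain ⟨A', hAC, hAB'⟩ := hYC.disjoint hZB (by omega) hq
    rw [hi'] at hAB'
    obtain ⟨rfl, rfl⟩ := hAB.unique hAB'
    exact ⟨Z, hAC, hZB⟩
  · rintro ⟨Z, hAC, hZB⟩
    have hconn : X.Conn j l := by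
      intro x x' hx1 hx2 hx1' hx2' hx hx'
      have key : ∀ x, j ≤ x → x < j + l → (∀ y, X.Edge x y → ¬ (j ≤ y ∧ y < j + l)) →
          ∀ y, Z.Edge x y → ¬ (j ≤ y ∧ y < j + l) := by
        intro x hx1 hx2 hx b hb
        obtain ⟨hne, x1, y, hxy, hx1, rfl⟩ := (hZB.outer _ _).1 hb
        have h3 := contr_spec (i + l - 1) m x1
        have h4 := contr_spec (i + l - 1) m y
        rw [show x1 = x by omega] at hxy
        have := hx y hxy
        omega
      exact hAC.conn x x' hx1 hx2 hx1' hx2' (key x hx1 hx2 hx) (key x' hx1' hx2' hx')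
    obtain ⟨Y, C', hYC⟩ := hconn.exists_isComp (n := p) hr (by omega) hl
    obtain ⟨A', hAC', hAB⟩ := hYC.disjoint hZB (by omega) hq
    rw [hi'] at hAB
    obtain ⟨rfl, rfl⟩ := hAC.unique hAC'
    exact ⟨Y, hAB, hYC⟩

/-! ### The order on trees -/

/-- `X ≤ Y` if `X` arises from `Y` by moving the parents of the vertices towards them. -/
instance : PartialOrder (LabelledTree (Fin n)) where
  le X Y := ∀ x y, X.Edge x y → ∃ z, Y.Edge x z ∧ (x < y ∧ y ≤ z ∨ z ≤ y ∧ y < x)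
  le_refl X x y h := ⟨y, h, by have := h.ne; omega⟩
  le_trans X Y Z h1 h2 x y h := by
    obtain ⟨z, hz, hz'⟩ := h1 x y h
    obtain ⟨t, ht, ht'⟩ := h2 x z hz
    exact ⟨t, ht, by omega⟩
  le_antisymm X Y h1 h2 := ext_of_edge_imp fun x y h => by
    obtain ⟨z, hz, hz'⟩ := h1 x y h
    obtain ⟨t, ht, ht'⟩ := h2 x z hz
    have := h.unique ht
    rwa [show y = z by omega]

theorem le_iff {X Y : LabelledTree (Fin n)} : X ≤ Y ↔
    ∀ x y, X.Edge x y → ∃ z, Y.Edge x z ∧ (x < y ∧ y ≤ z ∨ z ≤ y ∧ y < x) := Iff.rfl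

theorem root_eq_of_le {X Y : LabelledTree (Fin n)} (h : X ≤ Y) : X.root = Y.root := by
  by_contra hne
  obtain ⟨y, hy⟩ := X.exists_edge Y.root.2 (fun e => hne (Fin.ext e.symm))
  obtain ⟨z, hz, -⟩ := le_iff.1 h _ _ hy
  exact Y.not_edge_root z hz

/-- The composition of `T_Max` dominates all compositions of smaller trees. -/
theorem IsComp.le {T T' : LabelledTree (Fin n)} {i : ℕ} {S S' : LabelledTree (Fin m)}
    {X X' : LabelledTree (Fin p)} (h' : T'.IsComp i S' X') (h : T.IsComp i S X)
    (hX : X.MaxAtt i m) (hT : T' ≤ T) (hS : S' ≤ S) : X' ≤ X := by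
  have hm := h.pos_right
  have hr := root_eq_of_le hS
  rw [le_iff]
  intro x y hxy
  have hne := hxy.ne
  have hxs := contr_spec i m x
  have hys := contr_spec i m y
  by_cases he : contr i m x = contr i m y
  · have h1 := (h'.inner (x - i) (y - i) (by omega) (by omega)).2
      (by rwa [Nat.add_sub_cancel' (by omega), Nat.add_sub_cancel' (by omega)])
    obtain ⟨z, hz, hz'⟩ := le_iff.1 hS _ _ h1
    have h2 := (h.inner _ _ hz.lt_left hz.lt_right).1 hz
    rw [Nat.add_sub_cancel' (by omega)] at h2
    exact ⟨_, h2, by omega⟩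
  · have h1 := (h'.outer _ _).2 ⟨he, x, y, hxy, rfl, rfl⟩
    obtain ⟨b, hb, hb'⟩ := le_iff.1 hT _ _ h1
    obtain ⟨hne', x1, z, hz, hx1, rfl⟩ := (h.outer _ _).1 hb
    have hx1s := contr_spec i m x1
    have hzs := contr_spec i m z
    -- Both have the same contraction. Inside the block both are exits, hence roots of S and S',
    -- which agree because S' ≤ S.
    have : x1 = x := by
      by_cases hb : i ≤ x ∧ x < i + m
      · rw [h.eq_root (x := x1) (by omega) (by omega) (fun t ht => by rw [← hz.unique ht]; omega),
          h'.eq_root hb.1 hb.2 (fun t ht => by rw [← hxy.unique ht]; omega), hr]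
      · omega
    subst this
    refine ⟨z, hz, ?_⟩
    -- If z is entered from outside the block, it is the block label farthest from x, so y cannot
    -- lie beyond it.
    have := hX _ _ hz
    omega

/-- Two blocks of decompositions in `T_Max` do not overlap properly. -/
theorem IsComp.not_overlap {T : LabelledTree (Fin n)} {i : ℕ} {S : LabelledTree (Fin m)}
    {T' : LabelledTree (Fin q)} {k : ℕ} {S' : LabelledTree (Fin l)} {X : LabelledTree (Fin p)}
    (h : T.IsComp i S X) (hX : X.MaxAtt i m) (h' : T'.IsComp k S' X) (hX' : X.MaxAtt k l)
    (h1 : i < k) (h2 : k < i + m) (h3 : i + m < k + l) : False := by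
  have ha := h.arity
  have ha' := h'.arity
  have hi := h.lt
  have hk := h'.lt
  have hroot : ∀ y, X.Edge X.root y → ∀ P : Prop, P := fun y hy => absurd hy (X.not_edge_root y)
  obtain ⟨r, hr1, hr2, hr3⟩ := X.exists_exit (i := i) (m := m) (by omega) (by omega)
  obtain ⟨s, hs1, hs2, hs3⟩ := X.exists_exit (i := k) (m := l) (by omega) (by omega)
  have step : ∀ a b, X.Edge a b → i ≤ a → a < i + m → a ≠ r → i ≤ b ∧ b < i + m := by
    intro a b hab h4 h5 h6
    by_contra hb
    exact h6 (h.conn a r h4 h5 hr1 hr2 (fun y hy => by rwa [← hab.unique hy]) hr3)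
  have step' : ∀ a b, X.Edge a b → k ≤ a → a < k + l → a ≠ s → k ≤ b ∧ b < k + l := by
    intro a b hab h4 h5 h6
    by_contra hb
    exact h6 (h'.conn a s h4 h5 hs1 hs2 (fun y hy => by rwa [← hab.unique hy]) hs3)
  have hrr : i ≤ X.root.1 → X.root.1 < i + m → X.root.1 = r := fun h4 h5 =>
    h.conn _ r h4 h5 hr1 hr2 (fun y hy => hroot y hy _) hr3
  have hss : k ≤ X.root.1 → X.root.1 < k + l → X.root.1 = s := fun h4 h5 =>
    h'.conn _ s h4 h5 hs1 hs2 (fun y hy => hroot y hy _) hs3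
  -- Otherwise the part of the second block to the right of the first is closed under parents: an
  -- edge from it into the first block would end at i < k. It then contains the root, which must be
  -- s.
  have hs : i + m ≤ s := by
    by_contra hs
    have := X.root_mem_of_closed (fun a => i + m ≤ a ∧ a < k + l)
      (fun a b hab ⟨h4, h5⟩ => by
        have h6 := step' a b hab (by omega) h5 (by omega)
        have h7 := hX a b hab
        omega) (x := i + m) (by omega) (by omega)
    have := hss (by omega) (by omega)
    omega
  -- The mirror argument: an edge from [i, k) into the second block would end at its last label,
  -- beyond the first block.
  have hr : r < k := by
    by_contra hr
    have := X.root_mem_of_closed (fun a => i ≤ a ∧ a < k)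
      (fun a b hab ⟨h4, h5⟩ => by
        have h6 := step a b hab (by omega) (by omega) (by omega)
        have h7 := hX' a b hab
        omega) (x := i) (by omega) (by omega)
    have := hrr (by omega) (by omega)
    omega
  -- The overlap contains neither exit, so it is closed under parents and contains the root, which
  -- must be r < k.
  have := X.root_mem_of_closed (fun a => k ≤ a ∧ a < i + m)
    (fun a b hab ⟨h4, h5⟩ => by
      have h6 := step a b hab (by omega) (by omega) (by omega)
      have h7 := step' a b hab (by omega) (by omega) (by omega)
      omega) (x := k) (by omega) (by omega)
  have := hrr (by omega) (by omega)
  omega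

end LabelledTree

/-! ### Compositions as sums over finite sets of trees -/

namespace LabelledTree

variable {n m l p q r : ℕ}

instance : Finite (LabelledTree (Fin n)) :=
  Finite.of_injective LabelledTree.parent fun _ _ h =>
    ext_of_edge_imp fun _ _ ⟨hx, hy, hxy⟩ => ⟨hx, hy, h ▸ hxy⟩

instance : Subsingleton (LabelledTree (Fin 1)) :=
  ⟨fun _ _ => ext_of_edge_imp fun x y h => absurd h.ne (by
    have := h.lt_left
    have := h.lt_right
    omega)⟩

instance : Nonempty (LabelledTree (Fin 1)) :=
  ⟨⟨fun _ => none, 0, rfl, fun x => by rw [Subsingleton.elim x 0]⟩⟩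

instance : IsEmpty (LabelledTree (Fin 0)) := ⟨fun X => X.root.elim0⟩

/-- The trees `X` that restrict to `S` on a block and contract to `T`. -/
noncomputable def compSet (T : LabelledTree (Fin n)) (i : ℕ) (S : LabelledTree (Fin m)) (p : ℕ) :
    Finset (LabelledTree (Fin p)) :=
  (Set.toFinite {X | T.IsComp i S X}).toFinset

@[simp]
theorem mem_compSet {T : LabelledTree (Fin n)} {i : ℕ} {S : LabelledTree (Fin m)}
    {X : LabelledTree (Fin p)} : X ∈ T.compSet i S p ↔ T.IsComp i S X := by
  simp [compSet]

theorem sum_compAlong {M : Type*} [AddCommMonoid M] (h : n + m = p + 1) (T : LabelledTree (Fin n))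
    (i : Fin n) (S : LabelledTree (Fin m)) (F : LabelledTree (Fin p) → M) :
    ∑ f : T.In i → Fin m, F (T.compAlong h i S f) = ∑ X ∈ T.compSet i S p, F X := by
  refine Finset.sum_bij (fun f _ => T.compAlong h i S f) (fun f _ => ?_)
    (fun f _ g _ e => compAlong_injective h T i S e) (fun X hX => ?_) (fun _ _ => rfl)
  · exact mem_compSet.2 (isComp_compAlong h T i S f)
  · obtain ⟨f, hf⟩ := (mem_compSet.1 hX).exists_eq_compAlong
    exact ⟨f, Finset.mem_univ _, hf⟩

theorem isComp_one_left (U : LabelledTree (Fin 1)) {S X : LabelledTree (Fin n)} :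
    U.IsComp 0 S X ↔ X = S := by
  constructor
  · intro h
    exact (ext_of_edge_imp fun s t hst => by
      simpa using (h.inner s t hst.lt_left hst.lt_right).1 hst).symm
  · rintro rfl
    refine ⟨by omega, by omega, fun s t _ _ => by simp, fun a b => ⟨fun hab => ?_, ?_⟩⟩
    · have := hab.ne
      have := hab.lt_left
      have := hab.lt_right
      omega
    · rintro ⟨hne, x, y, hxy, hx, hy⟩
      have := hxy.lt_left
      have := hxy.lt_right
      have := contr_spec 0 n x
      have := contr_spec 0 n y
      omega

theorem isComp_one_right (U : LabelledTree (Fin 1)) {T X : LabelledTree (Fin n)} {i : ℕ}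
    (hi : i < n) : T.IsComp i U X ↔ X = T := by
  have hc : ∀ x, contr i 1 x = x := fun x => by
    have := contr_spec i 1 x
    omega
  constructor
  · intro h
    refine ext_of_edge_imp fun s t hst => (h.outer s t).2 ⟨hst.ne, s, t, hst, hc s, hc t⟩
  · rintro rfl
    refine ⟨rfl, hi, fun s t hs ht => ?_, fun a b => ?_⟩
    · obtain rfl : s = 0 := by omega
      obtain rfl : t = 0 := by omega
      exact ⟨fun h => absurd rfl h.ne, fun h => absurd rfl h.ne⟩
    · simp only [hc]
      exact ⟨fun h => ⟨h.ne, a, b, h, rfl, rfl⟩, by rintro ⟨-, x, y, h, rfl, rfl⟩; exact h⟩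

open Classical in
-- By `IsComp.unique` both double sums run over disjoint unions, so the equality of these unions,
-- `exists_isComp_assoc`, suffices.
theorem sum_compSet_assoc {M : Type*} [AddCommMonoid M] (A : LabelledTree (Fin n))
    (B : LabelledTree (Fin m)) (C : LabelledTree (Fin l)) {i j : ℕ} (hp : n + m = p + 1)
    (hr : p + l = r + 1) (hq : m + l = q + 1) (hi : i < n) (hj : j < m)
    (F : LabelledTree (Fin r) → M) :
    ∑ Y ∈ A.compSet i B p, ∑ X ∈ Y.compSet (i + j) C r, F X =
      ∑ Z ∈ B.compSet j C q, ∑ X ∈ A.compSet i Z r, F X := by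
  rw [← Finset.sum_biUnion, ← Finset.sum_biUnion]
  · congr 1
    ext X
    simpa using exists_isComp_assoc hp hr hq hi hj
  · intro Y _ Y' _ hne
    refine Finset.disjoint_left.2 fun X h h' => hne ?_
    exact ((mem_compSet.1 h).unique (mem_compSet.1 h')).2
  · intro Y _ Y' _ hne
    refine Finset.disjoint_left.2 fun X h h' => hne ?_
    exact ((mem_compSet.1 h).unique (mem_compSet.1 h')).1

open Classical in
theorem sum_compSet_comm {M : Type*} [AddCommMonoid M] (A : LabelledTree (Fin n))
    (B : LabelledTree (Fin m)) (C : LabelledTree (Fin l)) {i j : ℕ} (hp : n + m = p + 1)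
    (hr : p + l = r + 1) (hq : n + l = q + 1) (hi : i < n) (hji : j < i)
    (F : LabelledTree (Fin r) → M) :
    ∑ Y ∈ A.compSet i B p, ∑ X ∈ Y.compSet j C r, F X =
      ∑ Z ∈ A.compSet j C q, ∑ X ∈ Z.compSet (i + l - 1) B r, F X := by
  rw [← Finset.sum_biUnion, ← Finset.sum_biUnion]
  · congr 1
    ext X
    simpa using exists_isComp_comm hp hr hq hi hji
  · intro Y _ Y' _ hne
    refine Finset.disjoint_left.2 fun X h h' => hne ?_
    exact ((mem_compSet.1 h).unique (mem_compSet.1 h')).1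
  · intro Y _ Y' _ hne
    refine Finset.disjoint_left.2 fun X h h' => hne ?_
    exact ((mem_compSet.1 h).unique (mem_compSet.1 h')).1

end LabelledTree

/-! ### The pre-Lie operad is a reduced operad -/

namespace preLie

open LabelledTree

variable {k : Type u} [Field k] {n m l p q r : ℕ}

variable (k) in
/-- A tree as an element of the pre-Lie operad. -/
noncomputable def of (T : LabelledTree (Fin n)) : (preLie k).obj n :=
  (Finsupp.single T 1 : LabelledTree (Fin n) →₀ k)

/-- The linear map with prescribed values on the trees. -/
noncomputable def lift {M : Type*} [AddCommGroup M] [Module k M] (F : LabelledTree (Fin n) → M) :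
    (preLie k).obj n →ₗ[k] M :=
  Finsupp.linearCombination k F

theorem lift_of {M : Type*} [AddCommGroup M] [Module k M] (F : LabelledTree (Fin n) → M)
    (T : LabelledTree (Fin n)) : lift F (of k T) = F T := by
  refine (Finsupp.linearCombination_single k 1 T).trans ?_
  rw [one_smul]

theorem hom_ext {M : Type*} [AddCommGroup M] [Module k M] {F G : (preLie k).obj n →ₗ[k] M}
    (h : ∀ T, F (of k T) = G (of k T)) : F = G :=
  Finsupp.lhom_ext' fun T => LinearMap.ext_ring (h T)

theorem induction {P : (preLie k).obj n → Prop} (zero : P 0) (add : ∀ a b, P a → P b → P (a + b))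
    (smul : ∀ (c : k) a, P a → P (c • a)) (tree : ∀ T, P (of k T)) (a : (preLie k).obj n) : P a := by
  refine Finsupp.induction_linear (motive := P) a zero add fun T c => ?_
  have h := smul c _ (tree T)
  have e : c • of k T = (Finsupp.single T c : LabelledTree (Fin n) →₀ k) := by
    refine (Finsupp.smul_single c T (1 : k)).trans ?_
    rw [smul_eq_mul, mul_one]
  rwa [e] at h

theorem one_eq (U : LabelledTree (Fin 1)) : (preLie k).one = of k U :=
  congrArg (fun T : LabelledTree (Fin 1) => of k T) (Subsingleton.elim _ _)

theorem comp_of (h : n + m = p + 1) (i : Fin n) (T : LabelledTree (Fin n))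
    (S : LabelledTree (Fin m)) :
    (preLie k).comp h i (of k T) (of k S) = ∑ X ∈ T.compSet i S p, of k X := by
  rw [← sum_compAlong h T i S (of k)]
  have h1 : (preLie k).comp h i (of k T) =
      lift fun S => ∑ f : T.In i → Fin m, of k (T.compAlong h i S f) := lift_of (k := k) _ T
  rw [h1, lift_of]

theorem isOperad : (preLie k).IsOperad where
  assoc {n m l p q r} hp hr hq hr' i j a b c := by
    induction a using induction with
    | zero => simp only [map_zero, LinearMap.zero_apply]
    | add a a' ha ha' => simp only [map_add, LinearMap.add_apply, ha, ha']
    | smul s a ha => simp only [map_smul, LinearMap.smul_apply, ha]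
    | tree A =>
    induction b using induction with
    | zero => simp only [map_zero, LinearMap.zero_apply]
    | add a a' ha ha' => simp only [map_add, LinearMap.add_apply, ha, ha']
    | smul s a ha => simp only [map_smul, LinearMap.smul_apply, ha]
    | tree B =>
    induction c using induction with
    | zero => simp only [map_zero]
    | add a a' ha ha' => simp only [map_add, ha, ha']
    | smul s a ha => simp only [map_smul, ha]
    | tree C =>
    simp only [comp_of, map_sum, LinearMap.sum_apply]
    exact sum_compSet_assoc A B C hp hr hq i.2 j.2 _
  comm {n m l p q r} hp hr hq hr' i j hji a b c := by
    induction a using induction with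
    | zero => simp only [map_zero, LinearMap.zero_apply]
    | add a a' ha ha' => simp only [map_add, LinearMap.add_apply, ha, ha']
    | smul s a ha => simp only [map_smul, LinearMap.smul_apply, ha]
    | tree A =>
    induction b using induction with
    | zero => simp only [map_zero, LinearMap.zero_apply]
    | add a a' ha ha' => simp only [map_add, LinearMap.add_apply, ha, ha']
    | smul s a ha => simp only [map_smul, LinearMap.smul_apply, ha]
    | tree B =>
    induction c using induction with
    | zero => simp only [map_zero, LinearMap.zero_apply]
    | add a a' ha ha' => simp only [map_add, LinearMap.add_apply, ha, ha']
    | smul s a ha => simp only [map_smul, LinearMap.smul_apply, ha]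
    | tree C =>
    simp only [comp_of, map_sum, LinearMap.sum_apply]
    exact sum_compSet_comm A B C hp hr hq i.2 hji _
  one_comp {n} h a := by
    induction a using induction with
    | zero => simp only [map_zero]
    | add a a' ha ha' => simp only [map_add, ha, ha']
    | smul s a ha => simp only [map_smul, ha]
    | tree A =>
    obtain ⟨U⟩ := (inferInstance : Nonempty (LabelledTree (Fin 1)))
    rw [one_eq U, comp_of]
    rw [show U.compSet (0 : Fin 1).1 A n = {A} by
      ext X; simpa using isComp_one_left U, Finset.sum_singleton]
  comp_one {n} h i a := by
    induction a using induction with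
    | zero => simp only [map_zero, LinearMap.zero_apply]
    | add a a' ha ha' => simp only [map_add, LinearMap.add_apply, ha, ha']
    | smul s a ha => simp only [map_smul, LinearMap.smul_apply, ha]
    | tree A =>
    obtain ⟨U⟩ := (inferInstance : Nonempty (LabelledTree (Fin 1)))
    rw [one_eq U, comp_of]
    rw [show A.compSet i U n = {A} by
      ext X; simpa using isComp_one_right U i.2, Finset.sum_singleton]

theorem isReduced : (preLie k).IsReduced where
  zero := inferInstanceAs (Subsingleton (LabelledTree (Fin 0) →₀ k))
  one := by
    obtain ⟨U⟩ := (inferInstance : Nonempty (LabelledTree (Fin 1)))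
    have key : ∀ c : k, c • (preLie k).one = (Finsupp.single U c : LabelledTree (Fin 1) →₀ k) := by
      intro c
      rw [one_eq U]
      refine (Finsupp.smul_single c U (1 : k)).trans ?_
      rw [smul_eq_mul, mul_one]
    constructor
    · intro c d hcd
      simp only [key] at hcd
      exact Finsupp.single_injective U hcd
    · intro (a : LabelledTree (Fin 1) →₀ k)
      refine ⟨a U, (key _).trans ?_⟩
      refine Finsupp.ext fun T => ?_
      rw [Subsingleton.elim T U]
      exact Finsupp.single_eq_same

end preLie

/-! ### Maximal attachment after contracting or restricting to another block -/

namespace LabelledTree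

variable {n m l p q r : ℕ}

/-- Here a smaller block inside is contracted. The next three lemmas treat the restriction to a
larger block and the contraction of a block to the right or to the left. -/
theorem IsComp.maxAtt_outer {T : LabelledTree (Fin n)} {S : LabelledTree (Fin m)}
    {X : LabelledTree (Fin p)} {i j l b : ℕ} (h : T.IsComp (i + j) S X) (hX : X.MaxAtt i l)
    (hb : b + m = l + 1) (hj : j < b) : T.MaxAtt i b := by
  intro a c hac h1 h2
  obtain ⟨-, x, y, hxy, hx, hy⟩ := (h.outer _ _).1 hac
  have h3 := contr_spec (i + j) m x
  have h4 := contr_spec (i + j) m y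
  have h5 := hX x y hxy
  have := h.pos_right
  omega

theorem IsComp.maxAtt_inner {T : LabelledTree (Fin n)} {S : LabelledTree (Fin m)}
    {X : LabelledTree (Fin p)} {i j l : ℕ} (h : T.IsComp i S X) (hX : X.MaxAtt (i + j) l) :
    S.MaxAtt j l := by
  intro s t hst h1 h2
  have := hX _ _ ((h.inner s t hst.lt_left hst.lt_right).1 hst)
  omega

theorem IsComp.maxAtt_left {T : LabelledTree (Fin n)} {S : LabelledTree (Fin m)}
    {X : LabelledTree (Fin p)} {i k l : ℕ} (h : T.IsComp k S X) (hX : X.MaxAtt i l)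
    (hik : i + l ≤ k) : T.MaxAtt i l := by
  intro a c hac h1 h2
  obtain ⟨-, x, y, hxy, hx, hy⟩ := (h.outer _ _).1 hac
  have h3 := contr_spec k m x
  have h4 := contr_spec k m y
  have h5 := hX x y hxy
  have := h.pos_right
  omega

theorem IsComp.maxAtt_right {T : LabelledTree (Fin n)} {S : LabelledTree (Fin m)}
    {X : LabelledTree (Fin p)} {i k l : ℕ} (h : T.IsComp i S X) (hX : X.MaxAtt k l)
    (hik : i + m ≤ k) : T.MaxAtt (k + 1 - m) l := by
  intro a c hac h1 h2
  obtain ⟨-, x, y, hxy, hx, hy⟩ := (h.outer _ _).1 hac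
  have h3 := contr_spec i m x
  have h4 := contr_spec i m y
  have h5 := hX x y hxy
  have := h.pos_right
  omega

theorem lt_maxComp {T T' : LabelledTree (Fin n)} {i : Fin n} {S S' : LabelledTree (Fin m)}
    {X : LabelledTree (Fin p)} (h : n + m = p + 1) (h' : T'.IsComp i S' X) (hT : T' ≤ T)
    (hS : S' ≤ S) (hne : X ≠ T.maxComp h i S) : X < T.maxComp h i S :=
  lt_of_le_of_ne (h'.le (isComp_maxComp h T i S) (maxAtt_maxComp h T i S) hT hS) hne

end LabelledTree

/-! ### The defect of a linear family and its independence of the decomposition -/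

namespace preLie

open LabelledTree

variable {k : Type u} [Field k] {n m l p q r : ℕ} {Q : OperadData.{u, w} k}
  (φ : ∀ n, (preLie k).obj n →ₗ[k] Q.obj n)

/-- The failure of the family `φ` to preserve a composition. -/
noncomputable def defect (h : n + m = p + 1) (i : Fin n) :
    (preLie k).obj n →ₗ[k] (preLie k).obj m →ₗ[k] Q.obj p :=
  (Q.comp h i).compl₁₂ (φ n) (φ m) - ((preLie k).comp h i).compr₂ (φ p)

theorem defect_apply (h : n + m = p + 1) (i : Fin n) (a : (preLie k).obj n)
    (b : (preLie k).obj m) :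
    defect φ h i a b = Q.comp h i (φ n a) (φ m b) - φ p ((preLie k).comp h i a b) := rfl

/-- With a ∘ b and b ∘ c preserved, each defect is a triple composite in `Q` minus the image of the
triple composite, and associativity on both sides matches them. -/
theorem defect_assoc (hQ : Q.IsOperad) (hp : n + m = p + 1) (hr : p + l = r + 1)
    (hq : m + l = q + 1) (hr' : n + q = r + 1) (i : Fin n) (j : Fin m)
    (a : (preLie k).obj n) (b : (preLie k).obj m) (c : (preLie k).obj l)
    (hab : defect φ hp i a b = 0) (hbc : defect φ hq j b c = 0) :
    defect φ hr ⟨i + j, by omega⟩ ((preLie k).comp hp i a b) c =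
      defect φ hr' i a ((preLie k).comp hq j b c) := by
  rw [defect_apply, sub_eq_zero] at hab hbc
  rw [defect_apply, defect_apply, ← hab, ← hbc, hQ.assoc hp hr hq hr', isOperad.assoc hp hr hq hr']

theorem defect_comm (hQ : Q.IsOperad) (hp : n + m = p + 1) (hr : p + l = r + 1)
    (hq : n + l = q + 1) (hr' : q + m = r + 1) (i j : Fin n) (hji : j.1 < i.1)
    (a : (preLie k).obj n) (b : (preLie k).obj m) (c : (preLie k).obj l)
    (hab : defect φ hp i a b = 0) (hac : defect φ hq j a c = 0) :
    defect φ hr ⟨j, by omega⟩ ((preLie k).comp hp i a b) c =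
      defect φ hr' ⟨i + l - 1, by omega⟩ ((preLie k).comp hq j a c) b := by
  rw [defect_apply, sub_eq_zero] at hab hac
  rw [defect_apply, defect_apply, ← hab, ← hac, hQ.comm hp hr hq hr' i j hji,
    isOperad.comm hp hr hq hr' i j hji]

/-- All compositions of trees whose largest term is `X` are preserved by `φ`. -/
def PreservesAt (X : LabelledTree (Fin p)) : Prop :=
  ∀ (n m : ℕ) (h : n + m = p + 1) (T : LabelledTree (Fin n)) (i : Fin n) (S : LabelledTree (Fin m)),
    X = T.maxComp h i S → defect φ h i (of k T) (of k S) = 0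

/-- The other terms Y' of A ∘ B lie below Y, so the leading term of Y' ∘ C lies strictly below X and
its defect vanishes by induction. -/
theorem defect_comp_left (hp : n + m = p + 1) (hr : p + l = r + 1) (i : Fin n) (j : Fin p)
    {A : LabelledTree (Fin n)} {B : LabelledTree (Fin m)} {Y : LabelledTree (Fin p)}
    {C : LabelledTree (Fin l)} {X : LabelledTree (Fin r)} (hY : A.IsComp i B Y)
    (hYmax : Y.MaxAtt i m) (hX : Y.IsComp j C X) (hXmax : X.MaxAtt j l)
    (ih : ∀ X' < X, PreservesAt φ X') :
    defect φ hr j ((preLie k).comp hp i (of k A) (of k B)) (of k C) =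
      defect φ hr j (of k Y) (of k C) := by
  rw [comp_of, map_sum, LinearMap.sum_apply]
  refine Finset.sum_eq_single_of_mem Y (mem_compSet.2 hY) fun Y' hY' hne => ?_
  refine ih _ (lt_of_le_of_ne ((isComp_maxComp hr Y' j C).le hX hXmax
    ((mem_compSet.1 hY').le hY hYmax le_rfl le_rfl) le_rfl) fun e => hne ?_) _ _ hr Y' j C rfl
  have h1 := isComp_maxComp hr Y' j C
  rw [e] at h1
  exact (h1.unique hX).1

theorem defect_comp_right (hq : m + l = q + 1) (hr : n + q = r + 1) (i : Fin n) (j : Fin m)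
    {A : LabelledTree (Fin n)} {B : LabelledTree (Fin m)} {Z : LabelledTree (Fin q)}
    {C : LabelledTree (Fin l)} {X : LabelledTree (Fin r)} (hZ : B.IsComp j C Z)
    (hZmax : Z.MaxAtt j l) (hX : A.IsComp i Z X) (hXmax : X.MaxAtt i q)
    (ih : ∀ X' < X, PreservesAt φ X') :
    defect φ hr i (of k A) ((preLie k).comp hq j (of k B) (of k C)) =
      defect φ hr i (of k A) (of k Z) := by
  rw [comp_of, map_sum]
  refine Finset.sum_eq_single_of_mem Z (mem_compSet.2 hZ) fun Z' hZ' hne => ?_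
  refine ih _ (lt_of_le_of_ne ((isComp_maxComp hr A i Z').le hX hXmax le_rfl
    ((mem_compSet.1 hZ').le hZ hZmax le_rfl le_rfl)) fun e => hne ?_) _ _ hr A i Z' rfl
  have h1 := isComp_maxComp hr A i Z'
  rw [e] at h1
  exact (h1.unique hX).2

section diamond

variable (hQ : Q.IsOperad) {T : LabelledTree (Fin n)} {S : LabelledTree (Fin m)}
  {T' : LabelledTree (Fin q)} {S' : LabelledTree (Fin l)} {X : LabelledTree (Fin p)}
  {i : Fin n} {i' : Fin q}
  (h : T.IsComp i S X) (hX : X.MaxAtt i m) (h' : T'.IsComp i' S' X) (hX' : X.MaxAtt i' l)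
  (hm : 1 < m) (hq : 1 < q)
  (ihp : ∀ p' < p, ∀ X : LabelledTree (Fin p'), PreservesAt φ X)
  (ih : ∀ X' < X, PreservesAt φ X')

include hQ h hX h' hX' hm ihp ih

include hq in
-- The tree B of `IsComp.nested` makes T a term of T' ∘ B and S' a term of B ∘ S. Both compositions
-- have arity below p, so associativity equates the two defects once the lower terms are dropped.
theorem defect_eq_of_nested (h1 : i'.1 ≤ i) (h2 : i.1 + m ≤ i' + l) :
    defect φ h.arity i (of k T) (of k S) = defect φ h'.arity i' (of k T') (of k S') := by
  have ha := h.arity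
  have ha' := h'.arity
  obtain ⟨j, hj⟩ := Nat.exists_eq_add_of_le h1
  obtain ⟨b, hb⟩ : ∃ b, b + m = l + 1 := ⟨l + 1 - m, by omega⟩
  have hjb : j < b := by omega
  rw [hj] at h hX
  obtain ⟨B, hB, hB'⟩ := h'.nested h hb hjb
  have e1 := defect_assoc φ hQ hB'.arity ha hb ha' i' ⟨j, hjb⟩ (of k T') (of k B) (of k S)
    (ihp _ (by omega) _ _ _ _ _ _ _ rfl) (ihp _ (by omega) _ _ _ _ _ _ _ rfl)
  rw [defect_comp_left φ hB'.arity ha i' ⟨i' + j, by omega⟩ hB' (h.maxAtt_outer hX' hb hjb) h hX ih,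
    defect_comp_right φ hb ha' i' ⟨j, hjb⟩ hB (h'.maxAtt_inner hX) h' hX' ih] at e1
  rw [← e1]
  congr 2
  exact congrArg _ (Fin.ext hj)

/-- Contracting both blocks gives A, with T a term of A ∘ S' and T' a term of A ∘ S; parallel
commutation replaces associativity. -/
theorem defect_eq_of_disjoint (hl : 1 < l) (h1 : i.1 + m ≤ i') :
    defect φ h.arity i (of k T) (of k S) = defect φ h'.arity i' (of k T') (of k S') := by
  have ha := h.arity
  have ha' := h'.arity
  obtain ⟨b, hb⟩ : ∃ b, b + m = q + 1 := ⟨q + 1 - m, by omega⟩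
  obtain ⟨A, hA, hA'⟩ := h.disjoint h' h1 hb
  have hi : i' + 1 - m < b := by omega
  have e1 := defect_comm φ hQ hA'.arity ha hb ha' ⟨i' + 1 - m, hi⟩ ⟨i, by omega⟩ (by simp; omega)
    (of k A) (of k S') (of k S)
    (ihp _ (by omega) _ _ _ _ _ _ _ rfl) (ihp _ (by omega) _ _ _ _ _ _ _ rfl)
  have hi' : (⟨i' + 1 - m + m - 1, by omega⟩ : Fin q) = i' := Fin.ext (by simp; omega)
  simp only [hi', Fin.eta] at e1
  rwa [defect_comp_left φ hA'.arity ha ⟨i' + 1 - m, hi⟩ i hA' (h.maxAtt_right hX' h1) h hX ih,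
    defect_comp_left φ hb ha' ⟨i, by omega⟩ i' hA (h'.maxAtt_left hX h1) h' hX' ih] at e1

include hq in
theorem defect_eq (hn : 1 < n) (hl : 1 < l) :
    defect φ h.arity i (of k T) (of k S) = defect φ h'.arity i' (of k T') (of k S') := by
  have ha := h.arity
  have ha' := h'.arity
  by_cases h1 : i.1 + m ≤ i'
  · exact defect_eq_of_disjoint φ hQ h hX h' hX' hm ihp ih hl h1
  by_cases h2 : i'.1 + l ≤ i
  · exact (defect_eq_of_disjoint φ hQ h' hX' h hX hl ihp ih hm h2).symm
  by_cases h3 : i'.1 ≤ i ∧ i.1 + m ≤ i' + l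
  · exact defect_eq_of_nested φ hQ h hX h' hX' hm hq ihp ih h3.1 h3.2
  by_cases h4 : i.1 ≤ i' ∧ i'.1 + l ≤ i + m
  · exact (defect_eq_of_nested φ hQ h' hX' h hX hl hn ihp ih h4.1 h4.2).symm
  by_cases h5 : i.1 < i'
  · exact (h.not_overlap hX h' hX' h5 (by omega) (by omega)).elim
  · exact (h'.not_overlap hX' h hX (by omega) (by omega) (by omega)).elim

end diamond

/-- A family of linear maps that preserves the unit and one non-trivial composition with largest
term `X` for every decomposable tree `X` preserves all compositions. -/
theorem defect_eq_zero (hQ : Q.IsOperad) (hone : φ 1 (preLie k).one = Q.one)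
    (hdec : ∀ (p : ℕ) (X : LabelledTree (Fin p)), X.IsDecomposable →
      ∃ (n m : ℕ) (h : n + m = p + 1) (T : LabelledTree (Fin n)) (i : Fin n)
        (S : LabelledTree (Fin m)), 1 < n ∧ 1 < m ∧ X = T.maxComp h i S ∧
        defect φ h i (of k T) (of k S) = 0)
    (h : n + m = p + 1) (i : Fin n) : defect φ h i = 0 := by
  have key : ∀ p, ∀ X : LabelledTree (Fin p), PreservesAt φ X := by
    -- Induction on the arity, then along the order on the finitely many trees of that arity.
    intro p
    induction p using Nat.strong_induction_on with
    | _ p ihp =>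
    intro X
    induction X using WellFoundedLT.induction with
    | _ X ih =>
    rintro n m h T i S rfl
    by_cases hn : n = 1
    · subst hn
      obtain rfl : m = p := by omega
      obtain rfl : i = 0 := Subsingleton.elim _ _
      rw [← one_eq, defect_apply, hone, hQ.one_comp, isOperad.one_comp, sub_self]
    by_cases hm : m = 1
    · subst hm
      obtain rfl : n = p := by omega
      rw [← one_eq, defect_apply, hone, hQ.comp_one, isOperad.comp_one, sub_self]
    have hm' : 1 < m := by have := S.root.pos; omega
    have hn' : 1 < n := by have := i.pos; omega
    obtain ⟨q, l, h', T', i', S', hq, hl, e, h0⟩ := hdec p _ ⟨n, m, h, T, i, S, hn', hm', rfl⟩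
    -- The defect of the preserved decomposition is zero, and all non-trivial decompositions of the
    -- same tree share one defect.
    rw [← h0]
    refine defect_eq φ hQ (isComp_maxComp h T i S) (maxAtt_maxComp h T i S) (i' := i') ?_ ?_
      hm' hq ihp ih hn' hl
    · rw [e]
      exact isComp_maxComp h' T' i' S'
    · rw [e]
      exact maxAtt_maxComp h' T' i' S'
  exact hom_ext fun T => hom_ext fun S => key p _ n m h T i S rfl

end preLie

/-! ### Chosen decompositions and the extension of `g` -/

namespace LabelledTree

variable {p : ℕ}

/-- A non-trivial decomposition of `X` in the operad `T_Max`. -/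
structure MaxDecomp (X : LabelledTree (Fin p)) where
  n : ℕ
  m : ℕ
  arity : n + m = p + 1
  outer : LabelledTree (Fin n)
  idx : Fin n
  inner : LabelledTree (Fin m)
  one_lt_outer : 1 < n
  one_lt_inner : 1 < m
  eq : X = outer.maxComp arity idx inner

theorem isDecomposable_iff {X : LabelledTree (Fin p)} : X.IsDecomposable ↔ Nonempty X.MaxDecomp :=
  ⟨fun ⟨n, m, h, T, i, S, hn, hm, e⟩ => ⟨⟨n, m, h, T, i, S, hn, hm, e⟩⟩,
    fun ⟨⟨n, m, h, T, i, S, hn, hm, e⟩⟩ => ⟨n, m, h, T, i, S, hn, hm, e⟩⟩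

theorem MaxDecomp.isComp {X : LabelledTree (Fin p)} (d : X.MaxDecomp) :
    d.outer.IsComp d.idx d.inner X := by
  have h := isComp_maxComp d.arity d.outer d.idx d.inner
  rwa [← d.eq] at h

/-- This makes the recursion for `treeVal` terminate and drives the uniqueness proof. -/
theorem MaxDecomp.lt {X : LabelledTree (Fin p)} (d : X.MaxDecomp) {Y : LabelledTree (Fin p)}
    (hY : d.outer.IsComp d.idx d.inner Y) (hne : Y ≠ X) : Y < X := by
  have h := lt_maxComp d.arity hY le_rfl le_rfl (d.eq ▸ hne)
  rwa [← d.eq] at h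

theorem not_isDecomposable_of_le_one (X : LabelledTree (Fin p)) (hp : p ≤ 1) :
    ¬ X.IsDecomposable := by
  rintro ⟨n, m, h, T, i, S, hn, hm, -⟩
  omega

end LabelledTree

namespace preLie

open LabelledTree

variable {k : Type u} [Field k] {p : ℕ} (Q : OperadData.{u, w} k)

/-- The value on arity `n` of a family whose only non-zero member is the unit. -/
def unitVal : ∀ n, Q.obj n
  | 1 => Q.one
  | _ => 0

variable (g : ∀ n, IndecomposableTree n → Q.obj n)

open Classical in
/-- The image of a tree under the morphism that extends `g`. -/
noncomputable def treeVal : ∀ p, LabelledTree (Fin p) → Q.obj p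
  | p, X =>
    -- The value at X solves the equation that the chosen composition be preserved. The sum is over
    -- a subtype so that the termination proof knows Y < X.
    if hX : Nonempty X.MaxDecomp then
      Q.comp hX.some.arity hX.some.idx (treeVal hX.some.n hX.some.outer)
          (treeVal hX.some.m hX.some.inner) -
        ∑ Y : {Y // Y ∈ (hX.some.outer.compSet hX.some.idx hX.some.inner p).erase X},
          treeVal p Y.1
    else if hp : 2 ≤ p then g p ⟨X, hp, fun h => hX (isDecomposable_iff.1 h)⟩
    else unitVal Q p
-- Lexicographic in the arity and the number of smaller trees.
termination_by p X => (p, {Y | Y < X}.ncard)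
decreasing_by
  · refine Prod.Lex.left _ _ ?_
    have := hX.some.arity
    have := hX.some.one_lt_inner
    omega
  · refine Prod.Lex.left _ _ ?_
    have := hX.some.arity
    have := hX.some.one_lt_outer
    omega
  · refine Prod.Lex.right _ ?_
    have h := Finset.mem_erase.1 Y.2
    have hlt : Y.1 < X := hX.some.lt (mem_compSet.1 h.2) h.1
    exact Set.ncard_lt_ncard ⟨fun Z hZ => lt_trans hZ hlt,
      fun h => lt_irrefl Y.1 (h hlt)⟩ (Set.toFinite _)

theorem treeVal_of_indecomposable (X : IndecomposableTree p) : treeVal Q g p X.1 = g p X := by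
  rw [treeVal, dif_neg fun h => X.2.2 (isDecomposable_iff.2 h), dif_pos X.2.1]
  rfl

theorem treeVal_one (U : LabelledTree (Fin 1)) : treeVal Q g 1 U = Q.one := by
  rw [treeVal, dif_neg fun h => U.not_isDecomposable_of_le_one le_rfl (isDecomposable_iff.2 h),
    dif_neg (by omega)]
  rfl

/-- The recursion with the term X moved back into the sum: one preserved composition per
decomposable tree, as `defect_eq_zero` requires. -/
theorem exists_sum_treeVal (X : LabelledTree (Fin p)) (hX : X.IsDecomposable) :
    ∃ d : X.MaxDecomp, Q.comp d.arity d.idx (treeVal Q g d.n d.outer) (treeVal Q g d.m d.inner) =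
      ∑ Y ∈ d.outer.compSet d.idx d.inner p, treeVal Q g p Y := by
  classical
  have hX' := isDecomposable_iff.1 hX
  refine ⟨hX'.some, ?_⟩
  have h : treeVal Q g p X = _ - ∑ Y : {Y // Y ∈ _}, treeVal Q g p Y.1 :=
    (treeVal.eq_1 Q g p X).trans (dif_pos hX')
  rw [← Finset.add_sum_erase _ _ (mem_compSet.2 hX'.some.isComp), h, Finset.sum_coe_sort _
    (treeVal Q g p), sub_add_cancel]

variable {Q}

/-- The morphism of operads that extends `g`. -/
noncomputable def extend (hQ : Q.IsOperad) : OperadData.Hom (preLie k) Q where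
  app n := lift (treeVal Q g n)
  map_one := by
    obtain ⟨U⟩ := (inferInstance : Nonempty (LabelledTree (Fin 1)))
    rw [one_eq U, lift_of, treeVal_one]
  map_comp {n m p} h i a b := by
    have key := defect_eq_zero (fun n => lift (treeVal Q g n)) hQ
      (by
        obtain ⟨U⟩ := (inferInstance : Nonempty (LabelledTree (Fin 1)))
        rw [one_eq U, lift_of, treeVal_one])
      (fun p X hX => by
        obtain ⟨d, hd⟩ := exists_sum_treeVal Q g X hX
        refine ⟨d.n, d.m, d.arity, d.outer, d.idx, d.inner, d.one_lt_outer, d.one_lt_inner,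
          d.eq, ?_⟩
        rw [defect_apply, comp_of, map_sum, sub_eq_zero]
        simpa only [lift_of] using hd) h i
    have := congrArg (fun F => F a b) key
    exact (sub_eq_zero.1 this).symm

/-- For decomposable X, any one decomposition expresses the value at X by values in smaller arities
and at smaller trees, where the morphisms agree by induction. -/
theorem hom_eq_of_indecomposable (φ ψ : OperadData.Hom (preLie k) Q)
    (h : ∀ n (X : IndecomposableTree n), φ.app n (of k X.1) = ψ.app n (of k X.1)) : φ = ψ := by
  classical
  have key : ∀ p, ∀ X : LabelledTree (Fin p), φ.app p (of k X) = ψ.app p (of k X) := by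
    intro p
    induction p using Nat.strong_induction_on with
    | _ p ihp =>
    intro X
    induction X using WellFoundedLT.induction with
    | _ X ih =>
    by_cases hX : X.IsDecomposable
    · obtain ⟨d⟩ := isDecomposable_iff.1 hX
      have hn := d.one_lt_outer
      have hm := d.one_lt_inner
      have ha := d.arity
      have h1 := φ.map_comp ha d.idx (of k d.outer) (of k d.inner)
      have h2 := ψ.map_comp ha d.idx (of k d.outer) (of k d.inner)
      rw [ihp _ (by omega), ihp _ (by omega), ← h2, comp_of, map_sum, map_sum,
        ← Finset.add_sum_erase _ _ (mem_compSet.2 d.isComp),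
        ← Finset.add_sum_erase _ _ (mem_compSet.2 d.isComp),
        Finset.sum_congr rfl fun Y hY => ih Y (d.lt (mem_compSet.1 (Finset.mem_of_mem_erase hY))
          (Finset.ne_of_mem_erase hY))] at h1
      exact add_right_cancel h1
    · rcases Nat.lt_or_ge p 2 with hp | hp
      · have := X.root.pos
        obtain rfl : p = 1 := by omega
        rw [← one_eq, φ.map_one, ψ.map_one]
      · exact h p ⟨X, hp, hX⟩
  exact OperadData.Hom.ext (funext fun n => hom_ext (key n))

end preLie

theorem mainTheorem1 (k : Type u) [Field k] :
    (preLie k).IsReduced ∧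
      OperadData.IsFreeOn.{u, w} (preLie k) (X := IndecomposableTree)
        (fun _ X => Finsupp.single X.1 1) := by
  refine ⟨preLie.isReduced, preLie.isOperad, fun Q hQ g => ⟨preLie.extend g hQ, ?_, ?_⟩⟩
  · intro n X
    exact (preLie.lift_of _ X.1).trans (preLie.treeVal_of_indecomposable Q g X)
  · intro ψ hψ
    refine preLie.hom_eq_of_indecomposable _ _ fun n X => (hψ n X).trans ?_
    exact ((preLie.lift_of _ X.1).trans (preLie.treeVal_of_indecomposable Q g X)).symm
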